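/- For a finite group $G$ let $\Gamma(G)$ be the generating graph of $G$: its vertices are the nontrivial elements of $G$, and two distinct vertices are adjacent exactly when together they generate $G$. For $1\neq g\in G$ let $|g|$ be the order of $g$ and let $\delta(g)$ be the degree of $g$ in $\Gamma(G)$. Call a graph Eulerian if it is connected and has a closed walk going through every edge exactly once. The cycle shape of a permutation is the multiset of the lengths of its disjoint cycles, fixed points counting as cycles of length $1$. Let $n\geq 3$ be an integer, let $G=\mathrm{Alt}_n$ or $G=\mathrm{Sym}_n$, and let $e=2$ if $G=\mathrm{Alt}_n$ and $e=4$ if $G=\mathrm{Sym}_n$. For a prime number $p\equiv 3\pmod 4$ and an integer $k\geq 1$, consider decompositions $$n=\sum_{i=0}^k a_ip^i,\qquad a_k=1,\quad a_i\in\{0,1\}\ (0\leq i<k),\tag{$*$}$$ where, only when $G=\mathrm{Alt}_n$, it is also required that the number of nonzero $a_i$ with $i$ odd is odd. Let $1\neq g\in G$. (i) If $G=\mathrm{Sym}_3$, then $|N_G(\langle g\rangle)|\equiv 2\pmod 4$. (ii) If $G\neq\mathrm{Sym}_3$, then $|N_G(\langle g\rangle)|\not\equiv 0\pmod e$ if and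 only if there are a prime number $p\equiv 3\pmod 4$, an integer $k\geq 1$ and a decomposition $(*)$ such that $|g|=p^k$ and $g$ has cycle shape $\{p^i: a_i\neq 0\}$ (each such $p^i$ occurring exactly once). (iii) For every $G$ as above ($\mathrm{Sym}_3$ included), if there are no $p$, $k$ and decomposition $(*)$ such that $|g|=p^k$ and $g$ has cycle shape $\{p^i:a_i\neq 0\}$, then $\delta(g)$ is even. In particular, $\delta(g)$ is even if $|g|$ is not of the form $p^k$ with $p\equiv 3\pmod 4$ prime and $k\geq 1$, or if there is no decomposition $(*)$ with $p^k=|g|$. (iv) If $n$ has no decomposition $(*)$ for any prime number $p\equiv 3\pmod 4$ and any $k\geq 1$, then $\Gamma(G)$ is Eulerian. -/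

import Mathlib

/-- The generating graph of `G`: its vertices are the nontrivial elements of `G`, and two distinct
vertices are adjacent when together they generate `G`. -/
def generatingGraph (G : Type*) [Group G] : SimpleGraph {g : G // g ≠ 1} where
  Adj x y := x ≠ y ∧ Subgroup.closure {(x : G), (y : G)} = ⊤
  symm := ⟨fun x y h => ⟨h.1.symm, by rw [Set.pair_comm]; exact h.2⟩⟩
  loopless := ⟨fun _ h => h.1 rfl⟩

/-- The degree of the nontrivial element `g` in the generating graph of `G` (for finite `G`). -/
noncomputable def genDegree {G : Type*} [Group G] (g : G) (hg : g ≠ 1) : ℕ :=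
  ((generatingGraph G).neighborSet ⟨g, hg⟩).ncard

open Classical in
/-- A graph is Eulerian if it is connected and has a closed walk that goes through every edge
exactly once. -/
def IsEulerianGraph {V : Type*} (Γ : SimpleGraph V) : Prop :=
  Γ.Connected ∧ ∃ (v : V) (w : Γ.Walk v v), w.IsEulerian

/-- The order of the normalizer of the cyclic subgroup generated by `g`. -/
noncomputable def cyclicNormalizerCard {G : Type*} [Group G] (g : G) : ℕ :=
  Nat.card (Subgroup.normalizer (Subgroup.zpowers g : Set G))

/-- `p` is a prime congruent to `3` modulo `4`, `k` is positive, and `n = ∑_{i ≤ k} a_i p^i` with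
all `a_i ∈ {0, 1}` and `a_k = 1`. -/
structure IsDecomposition (n p k : ℕ) (a : ℕ → ℕ) : Prop where
  prime : p.Prime
  mod_four : p % 4 = 3
  pos : 0 < k
  digit : ∀ i ≤ k, a i = 0 ∨ a i = 1
  top : a k = 1
  sum_eq : n = ∑ i ∈ Finset.range (k + 1), a i * p ^ i

/-- The number of nonzero `a_i` with `i ≤ k` odd. -/
def oddDigitCount (k : ℕ) (a : ℕ → ℕ) : ℕ :=
  ((Finset.range (k + 1)).filter fun i => Odd i ∧ a i ≠ 0).card

/-- The cycle shape of `σ` (the multiset of its cycle lengths, a fixed point counting as a cycle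
of length `1`) consists of the `p ^ i` with `i ≤ k` and `a_i ≠ 0`, each occurring once. -/
def HasCycleShape {n : ℕ} (σ : Equiv.Perm (Fin n)) (p k : ℕ) (a : ℕ → ℕ) : Prop :=
  σ.partition.parts = ((Finset.range (k + 1)).filter fun i => a i ≠ 0).val.map fun i => p ^ i

/-! A mate of `g` is an element generating the group together with `g`; in a noncyclic group the
degree of `g` counts its mates. If `g` has even order `2m`, then `h ↦ h * g ^ m` pairs off the
mates. If an involution `t` normalizes `⟨g⟩` and lies in every subgroup of index 2, then mates not
commuting with `t` are paired by conjugation by `t`, and those commuting with it by `h ↦ h * t`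
(`even_ncard_mates_of_involution`). Thus odd degrees require a normalizer with few involutions.

In the symmetric group every generator of `⟨g⟩` is conjugate to `g`, so the normalizer has order
`φ(|g|) · |C(g)|`. For odd order, 4 fails to divide this exactly when `|g|` is a power of a prime `p
≡ 3 (mod 4)` and the centralizer has odd order, the latter meaning that the cycle lengths, fixed
points included, are distinct. This is the decomposition of `n`. In the alternating group the sign
of an involution inverting `g` enters as well: it fixes one point in each cycle of `g`, so it is a
product of `∑ (p ^ i - 1) / 2` transpositions, and the parity of this sum is that of the number of
odd exponents.

By Euler's theorem it remains to prove connectedness when there is no decomposition; this excludes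
`n = 3, 4`, and also `n = 7` in the alternating case. The mates used are permutations with two
cyclic orbits, or with a fixed point and two cyclic orbits, one of prime length `q`, a power of
which is a `q`-cycle. Block arguments make the generated group primitive, and Jordan's theorem (or
its transposition case, `q = 2`) makes it large. With two orbits any two nontrivial elements get a
common mate; with three, mates of the two elements are linked by an `n`-cycle. `Alt_6` leaves no
room for Jordan's theorem and is treated through explicit three-cycles. -/

namespace SimpleGraph

/-! ### Euler's theorem on closed trails -/

theorem Walk.IsTrail.length_le_ncard_edgeSet {V : Type*} [Finite V] {Γ : SimpleGraph V} {u v : V}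
    {p : Γ.Walk u v} (hp : p.IsTrail) : p.length ≤ Γ.edgeSet.ncard := by
  classical
  rw [← Walk.length_edges, ← List.toFinset_card_of_nodup hp.edges_nodup, ← Set.ncard_coe_finset]
  refine Set.ncard_le_ncard (fun e he => ?_) (Set.toFinite _)
  exact p.edges_subset_edgeSet (by simpa using he)

/-- The degree of a vertex counts the edges containing it. -/
theorem ncard_neighborSet_eq_ncard_incidenceSet {V : Type*} (Γ : SimpleGraph V)
    (v : V) : (Γ.neighborSet v).ncard = (Γ.incidenceSet v).ncard := by
  classical
  exact (Nat.card_congr (Γ.incidenceSetEquivNeighborSet v)).symm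

/-- A trail that ends at a vertex of even degree different from its start can be prolonged. -/
theorem Walk.IsTrail.exists_adj_notMem_edges {V : Type*} [Finite V] {Γ : SimpleGraph V} {u v : V}
    {p : Γ.Walk u v} (hp : p.IsTrail) (huv : u ≠ v) (hv : Even (Γ.neighborSet v).ncard) :
    ∃ w, Γ.Adj v w ∧ s(v, w) ∉ p.edges := by
  classical
  by_contra! h
  -- A trail uses an odd number of edges at an endpoint that differs from its start; if no edge at
  -- `v` were left over, this number would be the even degree.
  have h1 := hp.even_countP_edges_iff v
  rw [Γ.ncard_neighborSet_eq_ncard_incidenceSet] at hv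
  have h2 : Γ.incidenceSet v = ((p.edges.filter (v ∈ ·)).toFinset : Set (Sym2 V)) := by
    ext e
    simp only [List.coe_toFinset, List.mem_filter, decide_eq_true_eq, Set.mem_ofPred_eq]
    constructor
    · rintro ⟨he, hve⟩
      refine ⟨?_, hve⟩
      obtain ⟨w, rfl⟩ := Sym2.mem_iff_exists.1 hve
      exact h w he
    · rintro ⟨he, hve⟩
      exact ⟨p.edges_subset_edgeSet he, hve⟩
  rw [h2, Set.ncard_coe_finset, List.toFinset_card_of_nodup (hp.edges_nodup.filter _),
    ← List.countP_eq_length_filter, h1] at hv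
  exact (hv huv).2 rfl

/-- **Euler's theorem**: a finite connected graph with all degrees even has a closed Eulerian
walk. -/
theorem Connected.exists_isEulerian {V : Type*} [Finite V] [DecidableEq V] {Γ : SimpleGraph V}
    (hΓ : Γ.Connected) (h : ∀ v, Even (Γ.neighborSet v).ncard) :
    ∃ (v : V) (w : Γ.Walk v v), w.IsEulerian := by
  let P : ℕ → Prop := fun l => ∃ (u v : V) (p : Γ.Walk u v), p.IsTrail ∧ p.length = l
  have hP0 : ∃ l, P l := by
    obtain ⟨v⟩ := hΓ.nonempty
    exact ⟨0, v, v, Walk.nil, Walk.IsTrail.nil, rfl⟩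
  have hbd : ∀ l, P l → l ≤ Γ.edgeSet.ncard := by
    rintro l ⟨u, v, p, hp, rfl⟩
    exact hp.length_le_ncard_edgeSet
  classical
  obtain ⟨l0, hl0⟩ := hP0
  -- A trail of maximal length: it is closed, since otherwise it could be prolonged, and it contains
  -- all edges at its vertices, since it may be rotated to start anywhere. Connectedness then gives
  -- all vertices.
  obtain ⟨u, v, p, hp, hl⟩ := Nat.findGreatest_spec (hbd l0 hl0) hl0
  have hmax : ∀ u' v' (q : Γ.Walk u' v'), q.IsTrail → q.length ≤ p.length := fun u' v' q hq => by
    rw [hl]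
    exact Nat.le_findGreatest hq.length_le_ncard_edgeSet ⟨u', v', q, hq, rfl⟩
  have huv : u = v := by
    by_contra huv
    obtain ⟨w, hw, hwp⟩ := hp.exists_adj_notMem_edges huv (h v)
    have h1 := hmax _ _ (Walk.cons hw.symm p.reverse)
      (by
        rw [Walk.isTrail_cons]
        exact ⟨hp.reverse, by simpa [Sym2.eq_swap] using hwp⟩)
    simp at h1
  subst huv
  have key : ∀ a b, Γ.Adj a b → a ∈ p.support → s(a, b) ∈ p.edges := by
    intro a b hab ha
    by_contra hn
    have h1 := hmax _ _ (Walk.cons hab.symm (p.rotate a ha)) (by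
      rw [Walk.isTrail_cons]
      refine ⟨hp.rotate ha, ?_⟩
      rw [(p.rotate_edges a ha).mem_iff]
      simpa [Sym2.eq_swap] using hn)
    have h2 : (p.rotate a ha).length = p.length := by
      rw [← Walk.length_edges, ← Walk.length_edges]
      exact (p.rotate_edges a ha).perm.length_eq
    simp [h2] at h1
  have hall : ∀ a, a ∈ p.support := by
    intro a
    by_contra ha
    obtain ⟨q⟩ := hΓ.preconnected u a
    obtain ⟨d, -, hd1, hd2⟩ := q.exists_boundary_dart {x | x ∈ p.support} p.start_mem_support ha
    exact hd2 (p.snd_mem_support_of_mem_edges (key _ _ d.adj hd1))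
  refine ⟨u, p, hp.isEulerian_of_forall_mem ?_⟩
  intro e he
  induction e with
  | _ a b => exact key a b he (hall a)

end SimpleGraph

theorem isEulerianGraph_of_connected {G : Type*} [Group G] [Finite G]
    (hc : (generatingGraph G).Connected) (h : ∀ (g : G) (hg : g ≠ 1), Even (genDegree g hg)) :
    IsEulerianGraph (generatingGraph G) := by
  refine ⟨hc, ?_⟩
  let : DecidableEq {g : G // g ≠ 1} := fun a b => Classical.propDecidable (a = b)
  exact hc.exists_isEulerian fun v => h v v.2

/-! ### Parity of the number of mates -/

/-- A finite set with a fixed point free involution has even cardinality. -/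
theorem Set.even_ncard_of_involution {α : Type*} [Finite α] (S : Set α) (f : α → α)
    (hf : ∀ x ∈ S, f x ∈ S) (hff : ∀ x ∈ S, f (f x) = x) (hne : ∀ x ∈ S, f x ≠ x) :
    Even S.ncard := by
  classical
  have := Fintype.ofFinite α
  rw [Set.ncard_eq_toFinset_card', Finset.card_eq_sum_ones, ← ZMod.natCast_eq_zero_iff_even]
  push_cast
  refine Finset.sum_involution (fun a _ => f a) ?_ ?_ ?_ ?_
  · intros; decide
  · intro a ha _; exact hne a (by simpa using ha)
  · intro a ha; simpa using hf a (by simpa using ha)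
  · intro a ha; exact hff a (by simpa using ha)

namespace Subgroup

variable {G : Type*} [Group G]

/-- The set of elements generating the group together with `g`. -/
def mates (g : G) : Set G := {h | closure {g, h} = ⊤}

theorem mem_mates {g h : G} : h ∈ mates g ↔ closure {g, h} = ⊤ := Iff.rfl

theorem mates_of_mem {g h h' : G} (hh : h ∈ mates g) (K : h ∈ closure {g, h'}) : h' ∈ mates g := by
  rw [mem_mates, eq_top_iff, ← mem_mates.1 hh, closure_le]
  rintro x (rfl | rfl)
  · exact subset_closure (by simp)
  · exact K

variable [Finite G]

/-- The power `g ^ m` is an involution in `⟨g⟩`, so multiplying by it changes `h` but not the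
subgroup generated by `g` and `h`. -/
theorem even_ncard_mates_of_even_orderOf {g : G} (hg : Even (orderOf g)) :
    Even (mates g).ncard := by
  obtain ⟨m, hm⟩ := hg
  have hpos := orderOf_pos g
  have hsq : g ^ m * g ^ m = 1 := by rw [← pow_add, ← hm, pow_orderOf_eq_one]
  have hne : g ^ m ≠ 1 := pow_ne_one_of_lt_orderOf (by omega) (by omega)
  refine Set.even_ncard_of_involution _ (fun h => h * g ^ m) ?_ ?_ ?_
  · intro h hh
    refine mates_of_mem hh ?_
    have h1 : h * g ^ m ∈ closure {g, h * g ^ m} := subset_closure (by simp)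
    have h2 : g ∈ closure {g, h * g ^ m} := subset_closure (by simp)
    simpa using mul_mem h1 (inv_mem (pow_mem h2 m))
  · intro h _; simp [mul_assoc, hsq]
  · intro h _; simpa using hne

/-- Mates not commuting with `t` are paired by conjugation, which preserves `⟨g⟩`. For a mate `h`
commuting with `t`, the partner is `h * t`: the subgroup `K = ⟨g, h * t⟩` is normalized by `t`, and
`K` and `t` generate the group, so `K` would have index 2 if `t ∉ K`. The hypothesis on index 2
rules this out. -/
theorem even_ncard_mates_of_involution {g t : G} (ht : t ≠ 1) (htt : t * t = 1)
    (htn : t ∈ normalizer (zpowers g : Set G))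
    (hidx : ∀ K : Subgroup G, K.index = 2 → t ∈ K) :
    Even (mates g).ncard := by
  have htinv : t⁻¹ = t := inv_eq_of_mul_eq_one_left htt
  have hg : t * g * t ∈ zpowers g := by
    have := (mem_normalizer_iff.1 htn g).1 (mem_zpowers g)
    rwa [htinv] at this
  have hconj : ∀ x, t * (t * x * t) * t = x := fun x => by
    calc t * (t * x * t) * t = (t * t) * x * (t * t) := by group
      _ = x := by simp [htt]
  let F : Set G := {h | t * h * t = h}
  have hsplit : mates g = (mates g ∩ F) ∪ (mates g \ F) := (Set.inter_union_sdiff _ _).symm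
  rw [hsplit, Set.ncard_union_eq (Set.disjoint_sdiff_inter.symm)]
  refine Even.add ?_ ?_
  · refine Set.even_ncard_of_involution _ (fun h => h * t) ?_ ?_ ?_
    · rintro h ⟨hh, hF⟩
      have hcomm : t * h = h * t := by
        calc t * h = t * h * (t * t) := by simp [htt]
          _ = (t * h * t) * t := by group
          _ = h * t := by rw [hF]
      have hF' : t * (h * t) * t = h * t := by
        calc t * (h * t) * t = (t * h) * (t * t) := by group
          _ = h * t := by rw [htt, hcomm, mul_one]
      refine ⟨?_, hF'⟩
      set K := closure {g, h * t} with hK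
      have hgK : g ∈ K := subset_closure (by simp)
      have hhK : h * t ∈ K := subset_closure (by simp)
      suffices htK : t ∈ K by
        refine mates_of_mem hh ?_
        simpa using mul_mem hhK (inv_mem htK)
      by_contra htK
      have hzK : zpowers g ≤ K := zpowers_le.2 hgK
      have hKt : ∀ x ∈ K, t * x * t ∈ K := by
        intro x hx
        induction hx using closure_induction with
        | mem x hx =>
          rcases hx with rfl | rfl
          · exact hzK hg
          · rw [hF']; exact hhK
        | one => simp [htt]
        | mul x y _ _ hx hy =>
          have : t * (x * y) * t = (t * x * t) * (t * y * t) := by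
            calc t * (x * y) * t = t * x * 1 * y * t := by group
              _ = t * x * (t * t) * y * t := by rw [htt]
              _ = _ := by group
          rw [this]; exact mul_mem hx hy
        | inv x _ hx =>
          have : t * x⁻¹ * t = (t * x * t)⁻¹ := by simp [htinv, mul_assoc]
          rw [this]; exact inv_mem hx
      -- As `t` normalizes `K`, the union of `K` and `K * t` is a subgroup; it contains `g` and `h`.
      have hall : ∀ x, x ∈ K ∨ x * t ∈ K := by
        intro x
        have hx : x ∈ closure {g, h} := by rw [mem_mates.1 hh]; trivial
        induction hx using closure_induction with
        | mem x hx =>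
          rcases hx with rfl | rfl
          · exact .inl hgK
          · exact .inr hhK
        | one => exact .inl (one_mem _)
        | mul x y _ _ hx hy =>
          have e1 : x * y * t = x * (y * t) := by group
          have e2 : x * y = (x * t) * (t * (y * t) * t) := by
            calc x * y = x * 1 * y * 1 := by group
              _ = x * (t * t) * y * (t * t) := by rw [htt]
              _ = _ := by group
          have e3 : x * y * t = (x * t) * (t * y * t) := by
            calc x * y * t = x * 1 * y * t := by group
              _ = x * (t * t) * y * t := by rw [htt]
              _ = _ := by group
          rcases hx with hx | hx <;> rcases hy with hy | hy
          · exact .inl (mul_mem hx hy)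
          · exact .inr (e1 ▸ mul_mem hx hy)
          · exact .inr (e3 ▸ mul_mem hx (hKt _ hy))
          · exact .inl (e2 ▸ mul_mem hx (hKt _ hy))
        | inv x _ hx =>
          rcases hx with hx | hx
          · exact .inl (inv_mem hx)
          · refine .inr ?_
            have : x⁻¹ * t = t * (x * t)⁻¹ * t := by
              simp [htinv, ← mul_assoc, htt]
            rw [this]
            exact hKt _ (inv_mem hx)
      have hKidx : K.index = 2 := by
        rw [index_eq_two_iff]
        refine ⟨t, fun b => ?_⟩
        rcases hall b with hb | hb
        · exact .inr ⟨hb, fun h' => htK (by simpa using mul_mem (inv_mem hb) h')⟩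
        · exact .inl ⟨hb, fun h' => htK (by simpa using mul_mem (inv_mem h') hb)⟩
      exact htK (hidx K hKidx)
    · intro h _; simp [mul_assoc, htt]
    · intro h _; simpa using ht
  · refine Set.even_ncard_of_involution _ (fun h => t * h * t) ?_ ?_ ?_
    · rintro h ⟨hh, hF⟩
      refine ⟨?_, fun h' => hF ?_⟩
      · rw [mem_mates, ← mem_mates.1 (hh : h ∈ mates g)]
        have htop : ∀ x : G, x ∈ closure {g, t * h * t} := by
          intro x
          set K := closure {g, t * h * t} with hK
          have hgK : g ∈ K := subset_closure (by simp)
          have hhK : t * h * t ∈ K := subset_closure (by simp)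
          have hz : zpowers g ≤ K := zpowers_le.2 hgK
          suffices ∀ y ∈ closure {g, h}, t * y * t ∈ K by
            have := this (t * x * t) (by rw [mem_mates.1 hh]; trivial)
            rwa [hconj] at this
          intro y hy
          induction hy using closure_induction with
          | mem x hx =>
            rcases hx with rfl | rfl
            · exact hz hg
            · exact hhK
          | one => simp [htt]
          | mul x y _ _ hx hy =>
            have : t * (x * y) * t = (t * x * t) * (t * y * t) := by
              calc t * (x * y) * t = t * x * 1 * y * t := by group
                _ = t * x * (t * t) * y * t := by rw [htt]
                _ = _ := by group
            rw [this]; exact mul_mem hx hy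
          | inv x _ hx =>
            have : t * x⁻¹ * t = (t * x * t)⁻¹ := by simp [htinv, mul_assoc]
            rw [this]; exact inv_mem hx
        rw [mem_mates.1 hh, eq_top_iff]
        exact fun x _ => htop x
      · have h2 : t * (t * h * t) * t = t * h * t := h'
        rw [hconj] at h2
        exact h2.symm
    · intro h _; exact hconj h
    · rintro h ⟨-, hF⟩ h'; exact hF h'

end Subgroup

/-- The graph excludes the vertex 1 and loops; a mate equal to 1 or to `g` would make the group
cyclic, so nothing is lost. -/
theorem genDegree_eq_ncard_mates {G : Type*} [Group G] (hG : ¬ IsCyclic G) (g : G) (hg : g ≠ 1) :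
    genDegree g hg = (Subgroup.mates g).ncard := by
  rw [genDegree, ← Set.ncard_image_of_injective _ Subtype.val_injective]
  congr 1
  have hcyc : ∀ x : G, Subgroup.zpowers x ≠ ⊤ := fun x hx => hG ⟨x, fun y => by
    have : y ∈ Subgroup.zpowers x := hx ▸ Subgroup.mem_top y
    exact this⟩
  ext h
  simp only [Set.mem_image, SimpleGraph.mem_neighborSet, generatingGraph, Subgroup.mem_mates]
  constructor
  · rintro ⟨x, ⟨-, hx⟩, rfl⟩
    exact hx
  · intro hh
    have h1 : h ≠ 1 := by
      rintro rfl
      apply hcyc g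
      rw [Subgroup.zpowers_eq_closure, eq_top_iff, ← hh, Subgroup.closure_le]
      rintro x (rfl | rfl)
      · exact Subgroup.subset_closure rfl
      · exact one_mem _
    refine ⟨⟨h, h1⟩, ⟨?_, hh⟩, rfl⟩
    intro he
    have he' : g = h := congrArg Subtype.val he
    subst he'
    apply hcyc g
    rw [Subgroup.zpowers_eq_closure, ← hh, Set.pair_eq_singleton]

/-! ### Normalizers of cyclic subgroups of the symmetric group -/

open Equiv Equiv.Perm Subgroup MulAction
open scoped Pointwise

theorem Subgroup.mem_normalizer_zpowers_of_conj {G : Type*} [Group G] {c g : G}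
    (h : zpowers (c * g * c⁻¹) = zpowers g) : c ∈ normalizer (zpowers g : Set G) := by
  rw [mem_normalizer_iff]
  intro x
  have h1 : c * x * c⁻¹ ∈ zpowers (c * g * c⁻¹) ↔ x ∈ zpowers g := by
    simp only [mem_zpowers_iff, conj_zpow, mul_left_inj, mul_right_inj]
  rw [← h1, h]

theorem zpowers_pow_eq_of_coprime {G : Type*} [Group G] {g : G} {k : ℕ}
    (h : k.Coprime (orderOf g)) : zpowers (g ^ k) = zpowers g := by
  apply le_antisymm (zpowers_le.2 (pow_mem (mem_zpowers g) k))
  obtain ⟨m, hm⟩ := exists_pow_eq_self_of_coprime h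
  refine zpowers_le.2 (mem_zpowers_iff.2 ⟨m, ?_⟩)
  rw [zpow_natCast, hm]

section

variable {α : Type*} [Fintype α] [DecidableEq α]

theorem Equiv.Perm.cycleType_pow_of_coprime {σ : Perm α} {k : ℕ} (h : k.Coprime (orderOf σ)) :
    (σ ^ k).cycleType = σ.cycleType := by
  induction σ using cycle_induction_on with
  | base_one => simp
  | base_cycles σ hσ =>
    have h1 : (σ ^ k).IsCycle := hσ.pow_iff.2 h
    rw [h1.cycleType, hσ.cycleType, support_pow_coprime h]
  | induction_disjoint σ τ hd hσ ih1 ih2 =>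
    rw [hd.orderOf] at h
    rw [hd.commute.mul_pow, (hd.pow_disjoint_pow k k).cycleType_mul, hd.cycleType_mul,
      ih1 (h.coprime_dvd_right (Nat.dvd_lcm_left _ _)),
      ih2 (h.coprime_dvd_right (Nat.dvd_lcm_right _ _))]

/-- The automizer of a cyclic subgroup of the symmetric group is the full automorphism group. -/
theorem Equiv.Perm.cyclicNormalizerCard_eq (g : Perm α) :
    cyclicNormalizerCard g = (orderOf g).totient * Nat.card (centralizer {g}) := by
  -- An automorphism sends `g` to `g ^ k` with `k` prime to the order. This power has the cycle type
  -- of `g`, so some permutation realizes the automorphism by conjugation.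
  have hsurj : Function.Surjective (zpowers g).normalizerMonoidHom := by
    intro ψ
    obtain ⟨k, hk⟩ := (mem_powers_iff_mem_zpowers).2 (ψ ⟨g, mem_zpowers g⟩).2
    have hk : g ^ k = ψ ⟨g, mem_zpowers g⟩ := hk
    have ho : orderOf (g ^ k) = orderOf g := by
      rw [hk, Subgroup.orderOf_coe, MulEquiv.orderOf_eq, Subgroup.orderOf_mk]
    have hcop : k.Coprime (orderOf g) := by
      rw [orderOf_pow] at ho
      have h1 := Nat.div_mul_cancel (Nat.gcd_dvd_left (orderOf g) k)
      rw [ho] at h1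
      have := Nat.eq_of_mul_eq_mul_left (orderOf_pos g) (h1.trans (mul_one _).symm)
      rwa [Nat.coprime_comm]
    obtain ⟨c, hc⟩ := isConj_iff.1 (isConj_iff_cycleType_eq.2 (cycleType_pow_of_coprime hcop).symm)
    have hcN : c ∈ normalizer (zpowers g : Set (Perm α)) :=
      mem_normalizer_zpowers_of_conj (by rw [hc, zpowers_pow_eq_of_coprime hcop])
    refine ⟨⟨c, hcN⟩, ?_⟩
    ext ⟨x, hx⟩
    obtain ⟨j, rfl⟩ := hx
    have e1 : (⟨g ^ j, ⟨j, rfl⟩⟩ : zpowers g) = ⟨g, mem_zpowers g⟩ ^ j := rfl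
    change ((zpowers g).normalizerMonoidHom ⟨c, hcN⟩ ⟨g ^ j, ⟨j, rfl⟩⟩ : Perm α) _ =
      (ψ ⟨g ^ j, ⟨j, rfl⟩⟩ : Perm α) _
    rw [e1, map_zpow, map_zpow]
    congr 1
    rw [Subgroup.coe_zpow, Subgroup.coe_zpow, ← hk, ← hc]
    rfl
  have hker : Nat.card (zpowers g).normalizerMonoidHom.ker = Nat.card (centralizer {g}) := by
    rw [normalizerMonoidHom_ker]
    have h1 : centralizer (zpowers g : Set (Perm α)) = centralizer {g} := by
      rw [zpowers_eq_closure, centralizer_closure]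
    rw [Nat.card_congr (subgroupOfEquivOfLe (centralizer_le_normalizer _)).toEquiv, h1]
  rw [cyclicNormalizerCard, ← (zpowers g).normalizerMonoidHom.ker.card_mul_index, index_ker,
    MonoidHom.range_eq_top.2 hsurj, hker, Subgroup.card_top, IsCyclic.card_mulAut,
    Nat.card_zpowers, mul_comm]

theorem Nat.odd_factorial_iff {m : ℕ} : Odd m.factorial ↔ m ≤ 1 := by
  constructor
  · intro h
    by_contra! hm
    have := Nat.dvd_factorial two_pos hm
    rw [← Nat.not_even_iff_odd] at h
    exact h (even_iff_two_dvd.2 this)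
  · intro h
    interval_cases m <;> simp

theorem Multiset.odd_prod_iff {s : Multiset ℕ} : Odd s.prod ↔ ∀ x ∈ s, Odd x := by
  induction s using Multiset.induction_on with
  | empty => simp
  | cons a s ih => simp [Nat.odd_mul, ih]

/-- The centralizer is a product of wreath products: its order is the product of the cycle lengths,
odd here, times the factorials of the multiplicities of the lengths, 1 included. A factorial is odd
only for multiplicity at most 1. -/
theorem Equiv.Perm.odd_card_centralizer_iff {σ : Perm α} (hσ : Odd (orderOf σ)) :
    Odd (Nat.card (centralizer {σ})) ↔ σ.partition.parts.Nodup := by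
  have h1 : Odd σ.cycleType.prod := Multiset.odd_prod_iff.2 fun x hx =>
    hσ.of_dvd_nat (dvd_of_mem_cycleType hx)
  rw [nat_card_centralizer, Nat.odd_mul, Nat.odd_mul, parts_partition, Multiset.nodup_add,
    sum_cycleType, Nat.odd_factorial_iff, Finset.prod_eq_multiset_prod, Multiset.odd_prod_iff]
  have h2 : (∀ x ∈ Multiset.map (fun n => (σ.cycleType.count n).factorial)
      σ.cycleType.toFinset.val, Odd x) ↔ σ.cycleType.Nodup := by
    rw [Multiset.nodup_iff_count_le_one]
    simp only [Multiset.mem_map, forall_exists_index, and_imp, forall_apply_eq_imp_iff₂,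
      Nat.odd_factorial_iff, Finset.mem_val, Multiset.mem_toFinset]
    refine ⟨fun h x => ?_, fun h x _ => h x⟩
    by_cases hx : x ∈ σ.cycleType
    · exact h x hx
    · rw [Multiset.count_eq_zero.2 hx]; exact zero_le_one
  have h3 : _root_.Disjoint σ.cycleType (Multiset.replicate (Fintype.card α - σ.support.card) 1) := by
    rw [Multiset.disjoint_left]
    intro a ha ha'
    have := two_le_of_mem_cycleType ha
    rw [Multiset.eq_of_mem_replicate ha'] at this
    omega
  have h4 : (Multiset.replicate (Fintype.card α - σ.support.card) 1).Nodup ↔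
      Fintype.card α - σ.support.card ≤ 1 := by
    rw [Multiset.nodup_iff_count_le_one]
    refine ⟨fun h => by simpa using h 1, fun h x => ?_⟩
    exact (Multiset.count_le_card _ _).trans (by simpa using h)
  rw [Multiset.odd_prod_iff] at h1
  rw [Multiset.odd_prod_iff, h2, h4]
  tauto

end

/-- Two coprime odd factors above 1 each contribute a factor 2 to the totient, so `m` must be a
prime power; then `φ(p ^ k) = p ^ (k - 1) * (p - 1)`. -/
theorem Nat.not_four_dvd_totient_iff {m : ℕ} (hm : Odd m) (hm1 : m ≠ 1) :
    ¬ 4 ∣ m.totient ↔ ∃ p k : ℕ, p.Prime ∧ p % 4 = 3 ∧ 0 < k ∧ m = p ^ k := by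
  have hm0 : m ≠ 0 := by rintro rfl; simp at hm
  constructor
  · intro h
    have hp := Nat.minFac_prime hm1
    set p := m.minFac with hpdef
    obtain ⟨k, r, hr, hmk⟩ := Nat.exists_eq_pow_mul_and_not_dvd hm0 p hp.ne_one
    have hk : 0 < k := by
      rcases Nat.eq_zero_or_pos k with rfl | hk
      · rw [pow_zero, one_mul] at hmk
        exact absurd (hmk ▸ Nat.minFac_dvd m) hr
      · exact hk
    have hpo : Odd p := hm.of_dvd_nat (Nat.minFac_dvd m)
    have hp3 : 2 < p := lt_of_le_of_ne hp.two_le (by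
      rintro h2; rw [← h2] at hpo; exact absurd hpo (by decide))
    have hpk : 2 < p ^ k := hp3.trans_le (Nat.le_self_pow hk.ne' p)
    have hcop : (p ^ k).Coprime r := ((Nat.Prime.coprime_iff_not_dvd hp).2 hr).pow_left k
    have hro : Odd r := hm.of_dvd_nat (hmk ▸ Dvd.intro_left _ rfl)
    have hr1 : r = 1 := by
      by_contra hr1
      have hr2 : 2 < r := by
        obtain ⟨j, rfl⟩ := hro
        omega
      apply h
      rw [hmk, Nat.totient_mul hcop]
      exact mul_dvd_mul (even_iff_two_dvd.1 (Nat.totient_even hpk))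
        (even_iff_two_dvd.1 (Nat.totient_even hr2))
    rw [hr1, mul_one] at hmk
    refine ⟨p, k, hp, ?_, hk, hmk⟩
    by_contra h3
    apply h
    rw [hmk, Nat.totient_prime_pow hp hk]
    apply Dvd.dvd.mul_left
    obtain ⟨j, hj⟩ := hpo
    omega
  · rintro ⟨p, k, hp, hp3, hk, rfl⟩ h
    rw [Nat.totient_prime_pow hp hk] at h
    have hpo : Odd p := by rw [Nat.odd_iff]; omega
    have h4 : Nat.Coprime 4 (p ^ (k - 1)) :=
      Nat.Coprime.pow_right _ ((Nat.coprime_two_left.2 hpo).pow_left 2)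
    have := h4.dvd_of_dvd_mul_left h
    omega

/-- All cycle lengths are powers of `p`, so being distinct they are encoded by a set of exponents.
The exponent `k` occurs because the order is the least common multiple of the lengths. -/
theorem hasCycleShape_iff_nodup {n : ℕ} {σ : Perm (Fin n)} {p k : ℕ} (hp : p.Prime)
    (hp3 : p % 4 = 3) (hk : 0 < k) (ho : orderOf σ = p ^ k) :
    σ.partition.parts.Nodup ↔ ∃ a, IsDecomposition n p k a ∧ HasCycleShape σ p k a := by
  have hinj : Function.Injective (fun i => p ^ i) := Nat.pow_right_injective hp.two_le
  constructor
  · intro hnd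
    have hmem : ∀ x ∈ σ.partition.parts, ∃ i ≤ k, x = p ^ i := by
      intro x hx
      rw [parts_partition, Multiset.mem_add] at hx
      rcases hx with hx | hx
      · exact (Nat.dvd_prime_pow hp).1 (ho ▸ dvd_of_mem_cycleType hx)
      · exact ⟨0, Nat.zero_le _, by simpa using Multiset.eq_of_mem_replicate hx⟩
    let a : ℕ → ℕ := fun i => if p ^ i ∈ σ.partition.parts then 1 else 0
    have hshape : HasCycleShape σ p k a := by
      rw [HasCycleShape, Multiset.Nodup.ext hnd ((Finset.nodup _).map hinj)]
      intro x
      simp only [Multiset.mem_map, Finset.mem_val, Finset.mem_filter, Finset.mem_range, a]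
      constructor
      · intro hx
        obtain ⟨i, hi, rfl⟩ := hmem x hx
        exact ⟨i, ⟨by omega, by simp [hx]⟩, rfl⟩
      · rintro ⟨i, ⟨-, hi⟩, rfl⟩
        by_contra hx
        simp [hx] at hi
    refine ⟨a, ⟨hp, hp3, hk, fun i _ => ?_, ?_, ?_⟩, hshape⟩
    · by_cases h : p ^ i ∈ σ.partition.parts <;> simp [a, h]
    · suffices p ^ k ∈ σ.partition.parts by simp [a, this]
      by_contra hn
      have hdvd : σ.cycleType.lcm ∣ p ^ (k - 1) := by
        rw [Multiset.lcm_dvd]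
        intro x hx
        obtain ⟨i, hi, rfl⟩ := hmem x (by rw [parts_partition, Multiset.mem_add]; exact .inl hx)
        apply pow_dvd_pow
        by_contra! hik
        have : i = k := by omega
        subst this
        exact hn (by rw [parts_partition, Multiset.mem_add]; exact .inl hx)
      rw [lcm_cycleType, ho, Nat.pow_dvd_pow_iff_le_right hp.one_lt] at hdvd
      omega
    · have h1 := σ.partition.parts_sum
      rw [hshape, Fintype.card_fin] at h1
      rw [← h1]
      change ∑ i ∈ (Finset.range (k + 1)).filter (fun i => a i ≠ 0), p ^ i = _
      rw [Finset.sum_filter]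
      refine Finset.sum_congr rfl fun i _ => ?_
      by_cases h : p ^ i ∈ σ.partition.parts <;> simp [a, h]
  · rintro ⟨a, -, h⟩
    rw [h]
    exact (Finset.nodup _).map hinj

theorem not_four_dvd_cyclicNormalizerCard_iff_nodup {α : Type*} [Fintype α] [DecidableEq α]
    {g : Perm α} (hg : g ≠ 1) (ho : Odd (orderOf g)) :
    ¬ 4 ∣ cyclicNormalizerCard g ↔ ¬ 4 ∣ (orderOf g).totient ∧ g.partition.parts.Nodup := by
  have h1 : orderOf g ≠ 1 := by simpa using hg
  have h2 : 2 ∣ (orderOf g).totient := even_iff_two_dvd.1 (Nat.totient_even (by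
    obtain ⟨j, hj⟩ := ho
    omega))
  rw [cyclicNormalizerCard_eq, ← odd_card_centralizer_iff ho]
  set x := (orderOf g).totient
  set y := Nat.card (centralizer {g})
  constructor
  · intro h
    refine ⟨fun h4 => h (h4.mul_right y), ?_⟩
    rw [← Nat.not_even_iff_odd, even_iff_two_dvd]
    exact fun hy => h (mul_dvd_mul h2 hy)
  · rintro ⟨hx, hy⟩ h
    exact hx (((Nat.coprime_two_left.2 hy).pow_left 2).dvd_of_dvd_mul_right h)

theorem not_four_dvd_cyclicNormalizerCard_iff {n : ℕ} {g : Perm (Fin n)} (hg : g ≠ 1)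
    (ho : Odd (orderOf g)) :
    ¬ 4 ∣ cyclicNormalizerCard g ↔
      ∃ (p k : ℕ) (a : ℕ → ℕ), orderOf g = p ^ k ∧ IsDecomposition n p k a ∧
        HasCycleShape g p k a := by
  rw [not_four_dvd_cyclicNormalizerCard_iff_nodup hg ho,
    Nat.not_four_dvd_totient_iff ho (by simpa using hg)]
  constructor
  · rintro ⟨⟨p, k, hp, hp3, hk, hm⟩, hnd⟩
    obtain ⟨a, ha, hs⟩ := (hasCycleShape_iff_nodup hp hp3 hk hm).1 hnd
    exact ⟨p, k, a, hm, ha, hs⟩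
  · rintro ⟨p, k, a, hm, ha, hs⟩
    exact ⟨⟨p, k, ha.prime, ha.mod_four, ha.pos, hm⟩,
      (hasCycleShape_iff_nodup ha.prime ha.mod_four ha.pos hm).2 ⟨a, ha, hs⟩⟩

/-- Beyond order 2 the totient and the centralizer each contribute a factor 2. For an involution the
centralizer suffices: it contributes `2 ^ c` for `c` transpositions, and if `c = 1` the factorial of
the number of fixed points, at least 2, is even. -/
theorem four_dvd_cyclicNormalizerCard {α : Type*} [Fintype α] [DecidableEq α]
    (hα : 4 ≤ Fintype.card α) {g : Perm α} (ho : Even (orderOf g)) :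
    4 ∣ cyclicNormalizerCard g := by
  rw [cyclicNormalizerCard_eq]
  have h2 : 2 ∣ Nat.card (centralizer {g}) := by
    refine (even_iff_two_dvd.1 ho).trans ?_
    have := orderOf_dvd_natCard (⟨g, mem_centralizer_singleton_iff.2 rfl⟩ : centralizer {g})
    rwa [Subgroup.orderOf_mk] at this
  rcases lt_or_ge 2 (orderOf g) with h | h
  · exact mul_dvd_mul (even_iff_two_dvd.1 (Nat.totient_even h)) h2
  · have hm : orderOf g = 2 := by
      have := orderOf_pos g
      obtain ⟨j, hj⟩ := ho
      omega
    have hct : g.cycleType = Multiset.replicate (Multiset.card g.cycleType) 2 := by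
      rw [Multiset.eq_replicate_card]
      intro x hx
      have h3 := two_le_of_mem_cycleType hx
      have h4 := Nat.le_of_dvd (by omega) (dvd_of_mem_cycleType hx)
      omega
    have hc : 0 < Multiset.card g.cycleType := by
      rw [card_cycleType_pos]
      rintro rfl
      simp at hm
    apply Dvd.dvd.mul_left
    rw [nat_card_centralizer]
    apply Dvd.dvd.mul_right
    generalize Multiset.card g.cycleType = c at hct hc
    rw [hct, Multiset.prod_replicate, Multiset.sum_replicate, smul_eq_mul]
    rcases Nat.lt_or_ge 1 c with h1 | h1
    · exact Dvd.dvd.mul_left (pow_dvd_pow 2 h1) _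
    · have : c = 1 := by omega
      subst this
      have h2 : 2 ∣ (Fintype.card α - 1 * 2).factorial :=
        Nat.dvd_factorial two_pos (by omega)
      rw [pow_one]
      exact mul_dvd_mul h2 (dvd_refl 2)

/-! ### Involutions inverting an element, and their signs -/

section

variable {α : Type*} [Fintype α] [DecidableEq α]

theorem Equiv.Perm.cycleOf_conj (g t : Perm α) (x : α) :
    (t * g * t⁻¹).cycleOf (t x) = t * g.cycleOf x * t⁻¹ := by
  ext y
  obtain ⟨z, rfl⟩ := t.surjective y
  by_cases h : g.SameCycle x z
  · rw [SameCycle.cycleOf_apply (by simpa [sameCycle_conj] using h)]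
    simp [h.cycleOf_apply]
  · rw [cycleOf_apply_of_not_sameCycle (by simpa [sameCycle_conj] using h)]
    simp [cycleOf_apply_of_not_sameCycle h]

/-- If the cycles of `g` have different lengths, then an element inverting `g` preserves each of
them. -/
theorem Equiv.Perm.sameCycle_apply_of_conj_eq_inv {g t : Perm α} (hnd : g.partition.parts.Nodup)
    (ht : t * g * t⁻¹ = g⁻¹) (x : α) : g.SameCycle x (t x) := by
  rw [parts_partition, Multiset.nodup_add] at hnd
  by_cases hx : x ∈ g.support
  · have h1 : (g.cycleOf (t x)).support.card = (g.cycleOf x).support.card := by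
      have h2 := cycleOf_conj g t x
      rw [ht] at h2
      have h3 : (g.cycleOf (t x))⁻¹ = t * g.cycleOf x * t⁻¹ := by
        rw [← h2, cycleOf_inv]
        congr!
      rw [← support_inv, h3, card_support_conj]
    have htx : t x ∈ g.support := by
      rw [← support_inv, ← ht, mem_support]
      simpa using mem_support.1 hx
    have hinj := Multiset.inj_on_of_nodup_map (s := g.cycleFactorsFinset.1)
      (f := Finset.card ∘ support) (by rw [← cycleType_def]; exact hnd.1)
    have h3 := hinj _ (cycleOf_mem_cycleFactorsFinset_iff.2 htx) _
      (cycleOf_mem_cycleFactorsFinset_iff.2 hx) h1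
    exact (sameCycle_iff_cycleOf_eq_of_mem_support hx htx).2 h3.symm
  · have htx : t x ∉ g.support := by
      rw [← support_inv, ← ht, mem_support]
      simpa using mem_support.not.1 hx
    have hcard : g.supportᶜ.card ≤ 1 := by
      have h4 := Multiset.nodup_iff_count_le_one.1 hnd.2.1 1
      rw [Multiset.count_replicate_self] at h4
      rwa [Finset.card_compl]
    have := Finset.card_le_one.1 hcard x (by simpa using hx) (t x) (by simpa using htx)
    rw [← this]

/-- On each cycle, which is preserved and has odd length, `t` acts like a reflection `i ↦ j - i` of
a cyclic group of odd order, and so has exactly one fixed point. -/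
theorem Equiv.Perm.card_fixed_of_conj_eq_inv {g t : Perm α} (ho : Odd (orderOf g))
    (hnd : g.partition.parts.Nodup) (ht : t * g * t⁻¹ = g⁻¹) :
    t.supportᶜ.card = Multiset.card g.partition.parts := by
  have hsame := sameCycle_apply_of_conj_eq_inv hnd ht
  have hz : ∀ (j : ℤ) (x : α), t ((g ^ j) x) = (g ^ (-j)) (t x) := by
    intro j x
    have : t * g ^ j * t⁻¹ = g ^ (-j) := by rw [← conj_zpow, ht, inv_zpow, zpow_neg]
    rw [← this]
    simp
  obtain ⟨m, hm⟩ := ho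
  have hpow : g ^ (2 * m + 1 : ℤ) = 1 := by
    have := pow_orderOf_eq_one g
    rw [hm] at this
    exact_mod_cast this
  -- The number `m + 1` is the inverse of 2 modulo the order `2 * m + 1`; the fixed point on the
  -- cycle of `x` lies halfway from `x` to `t x`.
  have hpow' : ∀ j : ℤ, g ^ (2 * ((m + 1) * j)) = g ^ j := by
    intro j
    have : (2 * ((m + 1) * j) : ℤ) = (2 * m + 1) * j + j := by ring
    rw [this, zpow_add, zpow_mul, hpow, one_zpow, one_mul]
  have hexists : ∀ x, ∃ y, g.SameCycle x y ∧ t y = y := by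
    intro x
    obtain ⟨j, hj⟩ := hsame x
    refine ⟨(g ^ ((m + 1) * j)) x, ⟨_, rfl⟩, ?_⟩
    rw [hz, ← hj, ← mul_apply, ← hpow' j, ← zpow_add]
    congr 2
    ring
  have huniq : ∀ x y, g.SameCycle x y → t x = x → t y = y → x = y := by
    rintro x y ⟨j, rfl⟩ hx hy
    rw [hz, hx] at hy
    have h1 : (g ^ (2 * j)) x = x := by
      rw [two_mul, zpow_add, mul_apply, ← hy, ← mul_apply, ← zpow_add]
      simp
    have h2 : (g ^ j) x = x := by
      rw [← hpow', show (2 * ((m + 1) * j) : ℤ) = 2 * j * (m + 1) by ring, zpow_mul]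
      exact zpow_apply_eq_self_of_apply_eq_self h1 _
    exact h2.symm
  have hfix : ∀ x ∉ g.support, t x = x := by
    intro x hx
    obtain ⟨j, hj⟩ := hsame x
    rw [← hj]
    exact zpow_apply_eq_self_of_apply_eq_self (by simpa using hx) _
  rw [parts_partition, Multiset.card_add, Multiset.card_replicate, ← Finset.card_compl,
    cycleType_def, Multiset.card_map, ← Finset.card_def]
  rw [← Finset.card_filter_add_card_filter_not (s := t.supportᶜ) (· ∈ g.support)]
  congr 1
  · refine Finset.card_bij (fun x _ => g.cycleOf x) ?_ ?_ ?_
    · intro x hx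
      exact cycleOf_mem_cycleFactorsFinset_iff.2 (Finset.mem_filter.1 hx).2
    · intro x hx y hy hxy
      simp only [Finset.mem_filter, Finset.mem_compl, notMem_support] at hx hy
      exact huniq x y ((sameCycle_iff_cycleOf_eq_of_mem_support hx.2 hy.2).2 hxy) hx.1 hy.1
    · intro c hc
      obtain ⟨x, hx⟩ := (mem_cycleFactorsFinset_iff.1 hc).1.nonempty_support
      obtain ⟨y, hxy, hy⟩ := hexists x
      have hcx := cycle_is_cycleOf hx hc
      have hxs : x ∈ g.support := mem_cycleFactorsFinset_support_le hc hx
      refine ⟨y, ?_, ?_⟩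
      · simp only [Finset.mem_filter, Finset.mem_compl, notMem_support]
        exact ⟨hy, hxy.mem_support_iff.1 hxs⟩
      · rw [hcx, hxy.cycleOf_eq]
  · congr 1
    ext x
    simp only [Finset.mem_filter, Finset.mem_compl, notMem_support]
    refine ⟨fun h => by simpa using h.2, fun h => ⟨hfix x (by simpa using h), by simpa using h⟩⟩

/-- An element whose centralizer has odd order and that is conjugate to its inverse is inverted by
an involution. -/
theorem exists_involution_conj_eq_inv {G : Type*} [Group G] [Finite G] {g c : G}
    (hC : Odd (Nat.card (centralizer {g}))) (hc : c * g * c⁻¹ = g⁻¹) :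
    ∃ t : G, t * t = 1 ∧ t * g * t⁻¹ = g⁻¹ := by
  have hsq : c * c ∈ centralizer {g} := by
    rw [mem_centralizer_singleton_iff]
    have h1 : c * g = g⁻¹ * c := by rw [← hc]; group
    have h2 : c * g⁻¹ = g * c := by
      have := congrArg (·⁻¹) hc
      simp only [mul_inv_rev, inv_inv] at this
      calc c * g⁻¹ = c * (g⁻¹ * c⁻¹) * c := by group
        _ = g * c := by rw [this]
    calc c * c * g = c * (c * g) := by group
      _ = c * g⁻¹ * c := by rw [h1]; group
      _ = g * (c * c) := by rw [h2]; group
  obtain ⟨m, hm⟩ := hC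
  have hpow : (c * c) ^ (2 * m + 1) = 1 := by
    have := pow_card_eq_one' (x := (⟨c * c, hsq⟩ : centralizer {g}))
    rw [hm] at this
    exact congrArg Subtype.val this
  -- This is `c ^ (2 * m + 1)`, the odd part of the order of `c` being killed: `c ^ 2` centralizes
  -- `g`, so its order divides `2 * m + 1`.
  refine ⟨c * (c * c) ^ m, ?_, ?_⟩
  · rw [← hpow, ← pow_two c, ← pow_mul, ← pow_succ', ← pow_add, ← pow_mul]
    congr 1
    ring
  · have h3 : (c * c) ^ m * g * ((c * c) ^ m)⁻¹ = g := by
      have := mem_centralizer_singleton_iff.1 (pow_mem hsq m)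
      rw [this]; group
    calc c * (c * c) ^ m * g * (c * (c * c) ^ m)⁻¹
        = c * ((c * c) ^ m * g * ((c * c) ^ m)⁻¹) * c⁻¹ := by group
      _ = g⁻¹ := by rw [h3, hc]

end

/-- Modulo 4 the power `p ^ i` is 3 or 1 as `i` is odd or even, so `(p ^ i - 1) / 2` has the parity
of `i`. -/
theorem sum_pow_eq_card_add (F : Finset ℕ) {p : ℕ} (hp3 : p % 4 = 3) :
    ∃ s, ∑ i ∈ F, p ^ i = F.card + 2 * s ∧ s % 2 = (F.filter Odd).card % 2 := by
  have hpow : ∀ i, ∃ u, p ^ i = 1 + 2 * u ∧ u % 2 = if Odd i then 1 else 0 := by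
    intro i
    have h : p ^ i % 4 = if Odd i then 3 else 1 := by
      rw [Nat.pow_mod, hp3]
      induction i with
      | zero => simp
      | succ i ih =>
        rw [pow_succ, Nat.mul_mod, ih]
        by_cases hi : Odd i <;> simp [hi, Nat.odd_add_one]
    refine ⟨p ^ i / 2, ?_, ?_⟩ <;> split_ifs at * <;> omega
  induction F using Finset.induction_on with
  | empty => exact ⟨0, by simp⟩
  | insert i F hi ih =>
    obtain ⟨s, h1, h2⟩ := ih
    obtain ⟨u, h3, h4⟩ := hpow i
    refine ⟨s + u, ?_, ?_⟩
    · rw [Finset.sum_insert hi, h1, h3, Finset.card_insert_of_notMem hi]; ring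
    · rw [Finset.filter_insert]
      by_cases ho : Odd i
      · rw [if_pos ho] at h4 ⊢
        rw [Finset.card_insert_of_notMem (by simp [hi])]
        omega
      · rw [if_neg ho] at h4 ⊢
        omega

/-- The sign of an involution that inverts a permutation whose shape is given by a
decomposition. -/
theorem sign_of_conj_eq_inv {n : ℕ} {g t : Perm (Fin n)} {p k : ℕ} {a : ℕ → ℕ}
    (ho : orderOf g = p ^ k) (hd : IsDecomposition n p k a) (hs : HasCycleShape g p k a)
    (htt : t * t = 1) (ht : t * g * t⁻¹ = g⁻¹) :
    sign t = (-1) ^ oddDigitCount k a := by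
  have hpo : Odd p := by rw [Nat.odd_iff]; have := hd.mod_four; omega
  have hnd := (hasCycleShape_iff_nodup hd.prime hd.mod_four hd.pos ho).2 ⟨a, hd, hs⟩
  have h1 := card_fixed_of_conj_eq_inv (ho ▸ hpo.pow) hnd ht
  have h2 := g.partition.parts_sum
  rw [hs, Multiset.card_map, ← Finset.card_def] at h1
  rw [hs, Fintype.card_fin] at h2
  set F := (Finset.range (k + 1)).filter fun i => a i ≠ 0 with hF
  change ∑ i ∈ F, p ^ i = n at h2
  obtain ⟨s, h3, h4⟩ := sum_pow_eq_card_add F hd.mod_four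
  -- The sum of the lengths is `n` and `t` has one fixed point per cycle, so `t` is a product of `s`
  -- transpositions.
  have h5 : t.support.card = 2 * s := by
    have := Finset.card_add_card_compl t.support
    rw [Fintype.card_fin] at this
    omega
  have h6 : (F.filter Odd).card = oddDigitCount k a := by
    rw [oddDigitCount, hF, Finset.filter_filter]
    congr 1
    ext i
    simp [and_comm]
  rw [sign_of_pow_two_eq_one (by rw [pow_two, htt]), card_fixedPoints, sum_cycleType, h5,
    Nat.sub_sub_self (h5 ▸ t.support.card_le_univ), Nat.mul_div_cancel_left _ two_pos,
    ← h6, ← Nat.div_add_mod s 2, h4]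
  conv_rhs => rw [← Nat.div_add_mod (F.filter Odd).card 2]
  simp [pow_add, pow_mul]

/-! ### Normalizers in the alternating group -/

section

variable {α : Type*} [Fintype α] [DecidableEq α]

theorem mem_normalizer_zpowers_alternatingGroup {g t : alternatingGroup α} :
    t ∈ normalizer (zpowers g : Set (alternatingGroup α)) ↔
      (t : Perm α) ∈ normalizer (zpowers (g : Perm α) : Set (Perm α)) := by
  have key : ∀ x : alternatingGroup α, (x : Perm α) ∈ zpowers (g : Perm α) ↔ x ∈ zpowers g := by
    intro x
    simp only [mem_zpowers_iff]
    refine exists_congr fun k => ?_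
    rw [← Subgroup.coe_zpow, Subtype.coe_inj]
  have hle : zpowers (g : Perm α) ≤ alternatingGroup α := zpowers_le.2 g.2
  rw [mem_normalizer_iff, mem_normalizer_iff]
  constructor
  · intro h x
    by_cases hx : x ∈ alternatingGroup α
    · rw [key ⟨x, hx⟩, h, ← key]
      rfl
    · refine iff_of_false (fun h' => hx (hle h')) fun h' => hx ?_
      have := hle h'
      rw [mem_alternatingGroup, Perm.sign_mul, Perm.sign_mul, Perm.sign_inv, mul_comm, ← mul_assoc,
        Int.units_mul_self, one_mul] at this
      exact this
  · intro h x
    rw [← key, h, ← key]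
    rfl

/-- The sign restricted to the normalizer in the symmetric group has the normalizer in the
alternating group as kernel; `r` is the order of its image. -/
theorem exists_cyclicNormalizerCard_eq_mul (g : alternatingGroup α) :
    ∃ r, cyclicNormalizerCard (g : Perm α) = cyclicNormalizerCard g * r ∧ r ∣ 2 ∧
      ((∃ t ∈ normalizer (zpowers (g : Perm α) : Set (Perm α)), sign t = -1) → r = 2) := by
  set N := normalizer (zpowers (g : Perm α) : Set (Perm α)) with hN
  let s : N →* ℤˣ := sign.comp N.subtype
  have hker : Nat.card s.ker = cyclicNormalizerCard g := by
    rw [cyclicNormalizerCard, ← card_map_of_injective (K := s.ker) N.subtype_injective,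
      ← card_map_of_injective (f := (alternatingGroup α).subtype) (Subgroup.subtype_injective _)]
    congr 2
    ext t
    simp only [mem_map, MonoidHom.mem_ker, subtype_apply, Subtype.exists, exists_and_right,
      exists_eq_right, mem_normalizer_zpowers_alternatingGroup]
    constructor
    · rintro ⟨h1, h2⟩
      exact ⟨h2, h1⟩
    · rintro ⟨h1, h2⟩
      exact ⟨h2, h1⟩
  have hcard : Nat.card ℤˣ = 2 := by simp
  refine ⟨Nat.card s.range, ?_, hcard ▸ card_subgroup_dvd_card _, ?_⟩
  · rw [← hker, ← index_ker, card_mul_index, cyclicNormalizerCard]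
  · rintro ⟨t, ht, hts⟩
    have : s.range = ⊤ := by
      rw [eq_top_iff]
      intro u _
      rcases Int.units_eq_one_or u with rfl | rfl
      · exact one_mem _
      · exact ⟨⟨t, ht⟩, hts⟩
    rw [this, card_top, hcard]

theorem mem_alternatingGroup_of_odd_orderOf {g : Perm α} (ho : Odd (orderOf g)) :
    g ∈ alternatingGroup α := by
  rw [mem_alternatingGroup]
  have h1 : sign g ^ orderOf g = 1 := by rw [← map_pow, pow_orderOf_eq_one, map_one]
  rcases Int.units_eq_one_or (sign g) with h | h
  · exact h
  · rw [h, ho.neg_one_pow] at h1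
    exact absurd h1 (by decide)

theorem exists_conj_eq_inv_mem_normalizer {g : Perm α} (ho : Odd (orderOf g))
    (hnd : g.partition.parts.Nodup) :
    ∃ t : Perm α, t * t = 1 ∧ t * g * t⁻¹ = g⁻¹ ∧
      t ∈ normalizer (zpowers g : Set (Perm α)) := by
  obtain ⟨c, hc⟩ := isConj_iff.1 (isConj_iff_cycleType_eq.2 (cycleType_inv g).symm)
  obtain ⟨t, h1, h2⟩ := exists_involution_conj_eq_inv ((odd_card_centralizer_iff ho).2 hnd) hc
  exact ⟨t, h1, h2, mem_normalizer_zpowers_of_conj (by rw [h2, zpowers_inv])⟩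

end

theorem IsDecomposition.odd_pow {n p k : ℕ} {a : ℕ → ℕ} (h : IsDecomposition n p k a) :
    Odd (p ^ k) := by
  have := h.mod_four
  exact Odd.pow (by rw [Nat.odd_iff]; omega)

theorem even_cyclicNormalizerCard_of_even {G : Type*} [Group G] [Finite G] {g : G}
    (ho : Even (orderOf g)) : 2 ∣ cyclicNormalizerCard g := by
  have h := orderOf_dvd_natCard
    (⟨g, le_normalizer (mem_zpowers g)⟩ : normalizer (zpowers g : Set G))
  rw [Subgroup.orderOf_mk] at h
  exact (even_iff_two_dvd.1 ho).trans h

theorem cyclicNormalizerCard_three (g : Perm (Fin 3)) (hg : g ≠ 1) :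
    cyclicNormalizerCard g % 4 = 2 := by
  have h2 : 2 ∣ cyclicNormalizerCard g := by
    rcases Nat.even_or_odd (orderOf g) with ho | ho
    · exact even_cyclicNormalizerCard_of_even ho
    · rw [cyclicNormalizerCard_eq]
      refine Dvd.dvd.mul_right (even_iff_two_dvd.1 (Nat.totient_even ?_)) _
      have h1 : orderOf g ≠ 1 := by simpa using hg
      obtain ⟨j, hj⟩ := ho
      omega
  have h6 : cyclicNormalizerCard g ∣ 6 := by
    have := card_subgroup_dvd_card (normalizer (zpowers g : Set (Perm (Fin 3))))
    rwa [Nat.card_perm, Nat.card_fin] at this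
  have := Nat.le_of_dvd (by norm_num) h6
  interval_cases cyclicNormalizerCard g <;> omega

theorem not_four_dvd_cyclicNormalizerCard_iff_of_ne_three {n : ℕ} (hn : 4 ≤ n)
    {g : Perm (Fin n)} (hg : g ≠ 1) :
    ¬ 4 ∣ cyclicNormalizerCard g ↔
      ∃ (p k : ℕ) (a : ℕ → ℕ), orderOf g = p ^ k ∧ IsDecomposition n p k a ∧
        HasCycleShape g p k a := by
  rcases Nat.even_or_odd (orderOf g) with ho | ho
  · refine iff_of_false (not_not.2 (four_dvd_cyclicNormalizerCard (by simpa using hn) ho)) ?_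
    rintro ⟨p, k, a, h1, h2, -⟩
    rw [h1] at ho
    exact Nat.not_even_iff_odd.2 h2.odd_pow ho
  · exact not_four_dvd_cyclicNormalizerCard_iff hg ho

/-- Let `g` have odd order. Either side makes 4 fail to divide the order of the normalizer in the
symmetric group, so an involution `t` inverts `g`. If `t` is even, it lies in the normalizer in the
alternating group, which then has even order; if `t` is odd, that normalizer has index 2 in the full
one and therefore odd order. -/
theorem not_two_dvd_cyclicNormalizerCard_iff {n : ℕ} {g : alternatingGroup (Fin n)} (hg : g ≠ 1) :
    ¬ 2 ∣ cyclicNormalizerCard g ↔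
      ∃ (p k : ℕ) (a : ℕ → ℕ), orderOf g = p ^ k ∧ IsDecomposition n p k a ∧
        Odd (oddDigitCount k a) ∧ HasCycleShape (g : Perm (Fin n)) p k a := by
  have hog : orderOf (g : Perm (Fin n)) = orderOf g := Subgroup.orderOf_coe g
  have hg' : (g : Perm (Fin n)) ≠ 1 := fun h => hg (Subtype.ext h)
  rcases Nat.even_or_odd (orderOf g) with ho | ho
  · refine iff_of_false (not_not.2 (even_cyclicNormalizerCard_of_even ho)) ?_
    rintro ⟨p, k, a, h1, h2, -⟩
    rw [h1] at ho
    exact Nat.not_even_iff_odd.2 h2.odd_pow ho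
  · have ho' : Odd (orderOf (g : Perm (Fin n))) := hog ▸ ho
    obtain ⟨r, hr, hr2, hr3⟩ := exists_cyclicNormalizerCard_eq_mul g
    have h4 := not_four_dvd_cyclicNormalizerCard_iff hg' ho'
    rw [hog] at h4
    constructor
    · intro h
      have hn4 : ¬ 4 ∣ cyclicNormalizerCard (g : Perm (Fin n)) := by
        intro h'
        rw [hr] at h'
        rcases (Nat.dvd_prime Nat.prime_two).1 hr2 with rfl | rfl <;> omega
      obtain ⟨p, k, a, hm, hd, hs⟩ := h4.1 hn4
      refine ⟨p, k, a, hm, hd, ?_, hs⟩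
      have hnd := (hasCycleShape_iff_nodup hd.prime hd.mod_four hd.pos (hog.trans hm)).2
        ⟨a, hd, hs⟩
      obtain ⟨t, htt, ht, htN⟩ := exists_conj_eq_inv_mem_normalizer ho' hnd
      have hsign := sign_of_conj_eq_inv (hog.trans hm) hd hs htt ht
      by_contra hodd
      rw [Nat.not_odd_iff_even] at hodd
      rw [hodd.neg_one_pow] at hsign
      apply h
      have ht1 : t ≠ 1 := by
        rintro rfl
        have hgg : (g : Perm (Fin n)) ^ 2 = 1 := by
          rw [pow_two]
          nth_rw 1 [show (g : Perm (Fin n)) = (g : Perm (Fin n))⁻¹ by simpa using ht]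
          simp
        have h2 := orderOf_dvd_of_pow_eq_one hgg
        rcases (Nat.dvd_prime Nat.prime_two).1 h2 with h3 | h3
        · exact hg' (orderOf_eq_one_iff.1 h3)
        · rw [h3] at ho'
          exact absurd ho' (by decide)
      have h2 : orderOf t = 2 := orderOf_eq_prime (by rw [pow_two, htt]) ht1
      have h3 := orderOf_dvd_natCard (⟨⟨t, mem_alternatingGroup.2 hsign⟩, mem_normalizer_zpowers_alternatingGroup.2 htN⟩ :
        normalizer (zpowers g : Set (alternatingGroup (Fin n))))
      rwa [Subgroup.orderOf_mk, Subgroup.orderOf_mk, h2] at h3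
    · rintro ⟨p, k, a, hm, hd, hodd, hs⟩ h
      have hnd := (hasCycleShape_iff_nodup hd.prime hd.mod_four hd.pos (hog.trans hm)).2
        ⟨a, hd, hs⟩
      obtain ⟨t, htt, ht, htN⟩ := exists_conj_eq_inv_mem_normalizer ho' hnd
      have hsign := sign_of_conj_eq_inv (hog.trans hm) hd hs htt ht
      rw [hodd.neg_one_pow] at hsign
      have hr4 := hr3 ⟨t, htN, hsign⟩
      refine h4.2 ⟨p, k, a, hm, hd, hs⟩ ?_
      rw [hr, hr4]
      exact mul_dvd_mul h (dvd_refl 2)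

/-! ### Even degrees -/

section

variable {α : Type*} [Fintype α] [DecidableEq α]

/-- Three-cycles generate the alternating group, and each is the square of its own square. -/
theorem alternatingGroup_le_of_sq_mem {M : Subgroup (Perm α)}
    (h : ∀ a ∈ alternatingGroup α, a ^ 2 ∈ M) : alternatingGroup α ≤ M := by
  rw [← closure_three_cycles_eq_alternating, closure_le]
  intro c hc
  have h1 : c = (c ^ 2) ^ 2 := by
    have h3 : c ^ 3 = 1 := by
      have := pow_orderOf_eq_one c
      rwa [IsThreeCycle.orderOf hc] at this
    rw [← pow_mul, show 2 * 2 = 3 + 1 from rfl, pow_add, h3, one_mul, pow_one]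
  rw [SetLike.mem_coe, h1]
  exact h _ (pow_mem (IsThreeCycle.mem_alternatingGroup hc) 2)

theorem alternatingGroup_index_ne_two (K : Subgroup (alternatingGroup α)) : K.index ≠ 2 := by
  intro hK
  have h := alternatingGroup_le_of_sq_mem (M := K.map (alternatingGroup α).subtype) fun a ha =>
    ⟨⟨a, ha⟩ ^ 2, sq_mem_of_index_two hK _, rfl⟩
  have : K = ⊤ := by
    rw [eq_top_iff]
    intro x _
    obtain ⟨y, hy, hxy⟩ := h x.2
    rwa [← Subtype.ext hxy]
  rw [this, index_top] at hK
  omega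

/-- The index of the even part of the normalizer is at most 2, so the even part still contains an
involution. Being even, it lies in every subgroup of index 2, as these contain all squares. -/
theorem even_ncard_mates_perm {g : Perm α} (ho : Odd (orderOf g))
    (h4 : 4 ∣ cyclicNormalizerCard g) : Even (mates g).ncard := by
  have hgA := mem_alternatingGroup_of_odd_orderOf ho
  obtain ⟨r, hr, hr2, -⟩ := exists_cyclicNormalizerCard_eq_mul ⟨g, hgA⟩
  have h2 : 2 ∣ cyclicNormalizerCard (⟨g, hgA⟩ : alternatingGroup α) := by
    rw [show cyclicNormalizerCard g = _ from hr] at h4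
    rcases (Nat.dvd_prime Nat.prime_two).1 hr2 with rfl | rfl <;> omega
  obtain ⟨⟨⟨t, htA⟩, htN⟩, ht⟩ := exists_prime_orderOf_dvd_card' 2 h2
  rw [Subgroup.orderOf_mk, Subgroup.orderOf_mk] at ht
  refine even_ncard_mates_of_involution (t := t) ?_ ?_
    (mem_normalizer_zpowers_alternatingGroup.1 htN) fun K hK => ?_
  · rintro rfl; simp at ht
  · rw [← pow_two, ← ht, pow_orderOf_eq_one]
  · exact alternatingGroup_le_of_sq_mem (fun a _ => sq_mem_of_index_two hK a) htA

theorem even_ncard_mates_alternatingGroup {g : alternatingGroup α}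
    (h2 : 2 ∣ cyclicNormalizerCard g) : Even (mates g).ncard := by
  obtain ⟨⟨t, htN⟩, ht⟩ := exists_prime_orderOf_dvd_card' 2 h2
  rw [Subgroup.orderOf_mk] at ht
  refine even_ncard_mates_of_involution (t := t) ?_ ?_ htN fun K hK => ?_
  · rintro rfl; simp at ht
  · rw [← pow_two, ← ht, pow_orderOf_eq_one]
  · exact absurd hK (alternatingGroup_index_ne_two K)

end

theorem not_isCyclic_perm {n : ℕ} (hn : 3 ≤ n) : ¬ IsCyclic (Perm (Fin n)) := by
  intro h
  have hc := h.isMulCommutative.is_comm.comm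
    (swap (⟨0, by omega⟩ : Fin n) ⟨1, by omega⟩) (swap ⟨1, by omega⟩ ⟨2, by omega⟩)
  have := congrArg (fun σ : Perm (Fin n) => σ ⟨0, by omega⟩) hc
  simp [swap_apply_def] at this

theorem not_isCyclic_alternatingGroup {n : ℕ} (hn : 4 ≤ n) :
    ¬ IsCyclic (alternatingGroup (Fin n)) := by
  intro h
  let a : Fin n := ⟨0, by omega⟩
  let b : Fin n := ⟨1, by omega⟩
  let c : Fin n := ⟨2, by omega⟩
  let d : Fin n := ⟨3, by omega⟩
  have h1 : swap a b * swap a c ∈ alternatingGroup (Fin n) := by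
    simp [mem_alternatingGroup, a, b, c]
  have h2 : swap a b * swap a d ∈ alternatingGroup (Fin n) := by
    simp [mem_alternatingGroup, a, b, d]
  have hc := congrArg Subtype.val (h.isMulCommutative.is_comm.comm
    (⟨_, h1⟩ : alternatingGroup (Fin n)) ⟨_, h2⟩)
  have := congrArg (fun σ : Perm (Fin n) => σ c) hc
  simp [swap_apply_def, a, b, c, d] at this

theorem even_genDegree_perm {n : ℕ} (hn : 3 ≤ n) {g : Perm (Fin n)} (hg : g ≠ 1)
    (h : ¬ ∃ (p k : ℕ) (a : ℕ → ℕ), orderOf g = p ^ k ∧ IsDecomposition n p k a ∧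
      HasCycleShape g p k a) : Even (genDegree g hg) := by
  rw [genDegree_eq_ncard_mates (not_isCyclic_perm hn)]
  rcases Nat.even_or_odd (orderOf g) with ho | ho
  · exact even_ncard_mates_of_even_orderOf ho
  · rw [← not_four_dvd_cyclicNormalizerCard_iff hg ho, not_not] at h
    exact even_ncard_mates_perm ho h

theorem even_genDegree_alternatingGroup {n : ℕ} (hn : 3 ≤ n) {g : alternatingGroup (Fin n)}
    (hg : g ≠ 1)
    (h : ¬ ∃ (p k : ℕ) (a : ℕ → ℕ), orderOf g = p ^ k ∧ IsDecomposition n p k a ∧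
      Odd (oddDigitCount k a) ∧ HasCycleShape (g : Perm (Fin n)) p k a) :
    Even (genDegree g hg) := by
  rw [← not_two_dvd_cyclicNormalizerCard_iff hg, not_not] at h
  rcases hn.eq_or_lt with rfl | hn
  -- In degree 3 the group is cyclic, so degrees do not count mates; but its order 3 contradicts an
  -- even normalizer.
  · have h3 : cyclicNormalizerCard g ∣ 3 := by
      have := card_subgroup_dvd_card (normalizer (zpowers g : Set (alternatingGroup (Fin 3))))
      rwa [nat_card_alternatingGroup, Nat.card_fin] at this
    exact absurd (h.trans h3) (by norm_num)
  · rw [genDegree_eq_ncard_mates (not_isCyclic_alternatingGroup hn)]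
    exact even_ncard_mates_alternatingGroup h

/-! ### Jordan's theorem on cycles of prime length -/

/-- If `p ^ 2` does not divide the order of a group then its subgroups of order `p` are
conjugate. -/
theorem exists_conj_mem_zpowers_of_not_sq_dvd {K : Type*} [Group K] [Finite K] {p : ℕ}
    (hp : p.Prime) (hK : ¬ p ^ 2 ∣ Nat.card K) {a b : K} (ha : orderOf a = p)
    (hb : orderOf b = p) : ∃ k : K, k * a * k⁻¹ ∈ zpowers b := by
  have : Fact p.Prime := ⟨hp⟩
  have hfac : (Nat.card K).factorization p = 1 := by
    have h0 : Nat.card K ≠ 0 := Nat.card_pos.ne'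
    apply le_antisymm
    · by_contra! h
      exact hK ((hp.pow_dvd_iff_le_factorization h0).2 h)
    · rw [← hp.pow_dvd_iff_le_factorization h0, pow_one, ← ha]
      exact orderOf_dvd_natCard a
  let P : Sylow p K := Sylow.ofCard (zpowers a) (by rw [Nat.card_zpowers, ha, hfac, pow_one])
  let Q : Sylow p K := Sylow.ofCard (zpowers b) (by rw [Nat.card_zpowers, hb, hfac, pow_one])
  obtain ⟨k, hk⟩ := MulAction.exists_smul_eq K P Q
  refine ⟨k, ?_⟩
  have h1 : k * a * k⁻¹ ∈ (k • P : Sylow p K) := by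
    rw [Sylow.smul_def]
    exact Subgroup.smul_mem_pointwise_smul a (MulAut.conj k) (zpowers a) (mem_zpowers a)
  rw [hk] at h1
  exact h1

section

variable {α : Type*} [Fintype α] [DecidableEq α]

/-- Cycles of prime length `p` with the same support are conjugate up to powers in every
permutation group containing them, by an element that fixes the complement pointwise. -/
theorem Equiv.Perm.exists_conj_mem_zpowers {H : Subgroup (Perm α)} {σ τ : Perm α} {p : ℕ}
    (hp : p.Prime) (hσ : σ.IsCycle) (hτ : τ.IsCycle) (hσH : σ ∈ H) (hτH : τ ∈ H)
    (hcard : τ.support.card = p) (hs : σ.support = τ.support) :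
    ∃ k ∈ H, (∀ x ∉ τ.support, k x = x) ∧ k * σ * k⁻¹ ∈ zpowers τ := by
  let R : Subgroup (Perm α) := (ofSubtype : Perm {x // x ∈ τ.support} →* Perm α).range
  have hR : ∀ k : Perm α, (∀ x ∉ τ.support, k x = x) → k ∈ R := by
    intro k hk
    have h1 : ∀ x, k x ≠ x → x ∈ τ.support := fun x hx => by
      by_contra h
      exact hx (hk x h)
    exact ⟨_, ofSubtype_subtypePerm (f := k) (p := (· ∈ τ.support)) (fun x => by
      by_cases hx : k x = x
      · rw [hx]
      · exact iff_of_true (h1 _ (fun h => hx (k.injective h))) (h1 _ hx)) h1⟩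
  have hR' : ∀ k ∈ R, ∀ x ∉ τ.support, k x = x := by
    rintro _ ⟨f, rfl⟩ x hx
    exact ofSubtype_apply_of_not_mem f hx
  let K : Subgroup (Perm α) := H ⊓ R
  -- `K` embeds in the symmetric group on the `p` points of the support, and `p ^ 2` does not divide
  -- `p!`; so Sylow's theorem applies in `K`.
  have hKcard : ¬ p ^ 2 ∣ Nat.card K := by
    intro h
    have h1 : Nat.card K ∣ p.factorial := by
      refine (card_dvd_of_le (inf_le_right : K ≤ R)).trans ?_
      have := card_range_dvd (ofSubtype : Perm {x // x ∈ τ.support} →* Perm α)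
      rwa [Nat.card_perm, Nat.card_eq_fintype_card (α := {x // x ∈ τ.support}),
        Fintype.card_coe, hcard] at this
    have h2 := h.trans h1
    rw [← Nat.mul_factorial_pred hp.ne_zero, pow_two] at h2
    have h3 := Nat.dvd_of_mul_dvd_mul_left hp.pos h2
    rw [hp.dvd_factorial] at h3
    have := hp.pos
    omega
  have hσR : σ ∈ R := hR σ fun x hx => by rwa [← hs, notMem_support] at hx
  have hτR : τ ∈ R := hR τ fun x hx => by rwa [notMem_support] at hx
  have hσK : σ ∈ K := ⟨hσH, hσR⟩
  have hτK : τ ∈ K := ⟨hτH, hτR⟩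
  obtain ⟨⟨k, hkH, hkR⟩, hk⟩ := exists_conj_mem_zpowers_of_not_sq_dvd hp hKcard
    (a := ⟨σ, hσK⟩) (b := ⟨τ, hτK⟩)
    (by rw [Subgroup.orderOf_mk, hσ.orderOf, hs, hcard])
    (by rw [Subgroup.orderOf_mk, hτ.orderOf, hcard])
  refine ⟨k, hkH, hR' k hkR, ?_⟩
  obtain ⟨j, hj⟩ := hk
  exact ⟨j, congrArg Subtype.val hj⟩

/-- The pointwise stabilizer of the complement contains `τ`, so it is transitive on the support, and
primitive there because the degree is prime. Primitivity of `H` then propagates to multiple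
primitivity. -/
theorem Equiv.Perm.isMultiplyPretransitive_of_isCycle_mem {H : Subgroup (Perm α)}
    (hH : IsPreprimitive H α) {τ : Perm α} (hτ : τ.IsCycle) (hp : τ.support.card.Prime)
    (hτH : τ ∈ H) : IsMultiplyPretransitive H α (τ.support)ᶜ.card := by
  rcases Nat.eq_zero_or_pos (τ.support)ᶜ.card with h0 | hpos
  · rw [h0]
    exact is_zero_pretransitive
  have hadd := Finset.card_add_card_compl τ.support
  obtain ⟨d, hd⟩ : ∃ d, (τ.support)ᶜ.card = d + 1 := ⟨_, (Nat.succ_pred_eq_of_pos hpos).symm⟩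
  have h2 := hp.two_le
  have hsc : Set.ncard ((τ.support : Set α)ᶜ) = d + 1 := by
    rw [← Finset.coe_compl, Set.ncard_coe_finset, hd]
  have := isPretransitive_of_isCycle_mem hτ hτH
  have hprim : IsMultiplyPreprimitive H α (d + 2) := by
    refine hH.isMultiplyPreprimitive hsc (by rw [Nat.card_eq_fintype_card]; omega) ?_
    apply IsPreprimitive.of_prime_card
    convert! hp
    rw [← Set.ncard_coe_finset, ← Nat.card_coe_set_eq]
    refine Nat.card_congr (Equiv.subtypeEquivRight fun x => ?_)
    simp [SubMulAction.mem_ofFixingSubgroup_iff]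
  have h3 : IsMultiplyPretransitive H α (d + 2) := hprim.isMultiplyPretransitive
  rw [hd]
  exact isMultiplyPretransitive_of_le' (n := d + 2) (by omega)
    (by rw [ENat.card_eq_coe_fintype_card]; exact_mod_cast (by omega : d + 2 ≤ Fintype.card α))

theorem Equiv.Perm.exists_mem_eqOn_compl_support {H : Subgroup (Perm α)} {τ : Perm α}
    (hH : IsMultiplyPretransitive H α (τ.support)ᶜ.card) (π : Perm α) :
    ∃ h ∈ H, ∀ x ∉ τ.support, h x = π x := by
  let e : Fin (τ.support)ᶜ.card ↪ α :=
    (τ.supportᶜ.equivFin.symm.toEmbedding).trans (Function.Embedding.subtype _)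
  obtain ⟨⟨h, hH⟩, hh⟩ := hH.exists_smul_eq e (e.trans π.toEmbedding)
  refine ⟨h, hH, fun x hx => ?_⟩
  have := DFunLike.congr_fun hh (τ.supportᶜ.equivFin ⟨x, by simpa using hx⟩)
  simpa [e, Function.Embedding.smul_apply] using this

theorem Equiv.Perm.isThreeCycle_pow {σ : Perm α} (hσ : σ.IsThreeCycle) {k : ℕ}
    (hk : k.Coprime 3) : (σ ^ k).IsThreeCycle := by
  rw [← card_support_eq_three_iff, support_pow_coprime (by rwa [hσ.orderOf]), hσ.card_support]

/-- **Jordan's theorem** on primitive groups containing a cycle of prime length. -/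
theorem alternatingGroup_le_of_isPreprimitive_of_prime_cycle_mem {H : Subgroup (Perm α)}
    (hH : IsPreprimitive H α) {τ : Perm α} (hτ : τ.IsCycle) (hτH : τ ∈ H)
    (hp : τ.support.card.Prime) (hcard : τ.support.card = 3 ∨ τ.support.card + 3 ≤ Fintype.card α) :
    alternatingGroup α ≤ H := by
  by_cases h3 : τ.support.card = 3
  · exact alternatingGroup_le_of_isPreprimitive_of_isThreeCycle_mem hH
      (card_support_eq_three_iff.1 h3) hτH
  have hcard := hcard.resolve_left h3
  set p := τ.support.card with hpdef
  have htrans := isMultiplyPretransitive_of_isCycle_mem hH hτ hp hτH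
  have hadd := Finset.card_add_card_compl τ.support
  obtain ⟨a, b, c, ha, hb, hc, hab, hac, hbc⟩ :=
    Finset.two_lt_card_iff.1 (show 2 < (τ.support)ᶜ.card by omega)
  simp only [Finset.mem_compl] at ha hb hc
  -- Any transposition of fixed points of `τ` is induced by an element of `H` normalizing `⟨τ⟩`:
  -- lift it by multiple transitivity, then correct by an element of `H` that is trivial off the
  -- support and conjugates the moved cycle back into `⟨τ⟩`.
  have key : ∀ x y, x ∉ τ.support → y ∉ τ.support → ∃ u ∈ H, (∀ z ∉ τ.support, u z = swap x y z) ∧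
      ∃ j : ℤ, u * τ * u⁻¹ = τ ^ j := by
    intro x y hx hy
    obtain ⟨h, hhH, hh⟩ := exists_mem_eqOn_compl_support htrans (swap x y)
    have hmem : ∀ z, z ∉ τ.support → h z ∉ τ.support := by
      intro z hz
      rw [hh z hz]
      by_cases h1 : z = x
      · rwa [h1, swap_apply_left]
      · by_cases h2 : z = y
        · rwa [h2, swap_apply_right]
        · rwa [swap_apply_of_ne_of_ne h1 h2]
    have hsupp : (h * τ * h⁻¹).support = τ.support := by
      symm
      apply Finset.eq_of_subset_of_card_le
      · intro z hz
        rw [support_conj, Finset.mem_map]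
        refine ⟨h⁻¹ z, ?_, by simp⟩
        by_contra h'
        exact hmem _ h' (by simpa using hz)
      · rw [card_support_conj]
    obtain ⟨k, hkH, hk, j, hj⟩ := exists_conj_mem_zpowers hp hτ.conj hτ
      (mul_mem (mul_mem hhH hτH) (inv_mem hhH)) hτH rfl hsupp
    refine ⟨k * h, mul_mem hkH hhH, fun z hz => ?_, j, ?_⟩
    · rw [mul_apply, hk _ (hmem z hz), hh z hz]
    · change τ ^ j = _ at hj
      rw [hj]; group
  obtain ⟨u, huH, hu, i, hi⟩ := key a b ha hb
  obtain ⟨v, hvH, hv, j, hj⟩ := key a c ha hc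
  -- The automorphisms of `⟨τ⟩` commute, so this commutator centralizes `τ`; off the support it is
  -- the commutator of two overlapping transpositions, a three-cycle.
  set w := (u⁻¹ * v⁻¹) * (u * v) with hw
  have hwH : w ∈ H := mul_mem (mul_mem (inv_mem huH) (inv_mem hvH)) (mul_mem huH hvH)
  have hcomm : w * τ * w⁻¹ = τ := by
    have e1 : (u * v) * τ * (u * v)⁻¹ = τ ^ (i * j) := by
      calc (u * v) * τ * (u * v)⁻¹ = u * (v * τ * v⁻¹) * u⁻¹ := by group
        _ = τ ^ (i * j) := by rw [hj, ← conj_zpow, hi, zpow_mul]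
    have e2 : (v * u) * τ * (v * u)⁻¹ = τ ^ (i * j) := by
      calc (v * u) * τ * (v * u)⁻¹ = v * (u * τ * u⁻¹) * v⁻¹ := by group
        _ = τ ^ (i * j) := by rw [hi, ← conj_zpow, hj, mul_comm i j, zpow_mul]
    calc w * τ * w⁻¹ = (v * u)⁻¹ * ((u * v) * τ * (u * v)⁻¹) * (v * u) := by rw [hw]; group
      _ = (v * u)⁻¹ * ((v * u) * τ * (v * u)⁻¹) * (v * u) := by rw [e1, e2]
      _ = τ := by group
  have hcomm' : Commute w τ := by
    have : w * τ = τ * w := by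
      nth_rw 2 [← hcomm]
      group
    exact this
  let s := swap a b * swap a c
  have hs3 : s.IsThreeCycle := isThreeCycle_swap_mul_swap_same hab hac hbc
  have hss3 : (s * s).IsThreeCycle := hs3.isThreeCycle_sq
  have hinv : ∀ (f g : Perm α), (∀ z ∉ τ.support, f z = g z) → (∀ z ∈ τ.support, g z = z) →
      ∀ z ∉ τ.support, f⁻¹ z = g⁻¹ z := by
    intro f g hf hg z hz
    have h1 : g⁻¹ z ∉ τ.support := by
      intro h'
      have := hg _ h'
      rw [← mul_apply, mul_inv_cancel, one_apply] at this
      exact hz (this ▸ h')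
    rw [inv_eq_iff_eq, hf _ h1, ← mul_apply, mul_inv_cancel, one_apply]
  have hswap : ∀ x y, x ∉ τ.support → y ∉ τ.support → ∀ z ∈ τ.support, swap x y z = z := by
    intro x y hx hy z hz
    exact swap_apply_of_ne_of_ne (fun h => hx (h ▸ hz)) (fun h => hy (h ▸ hz))
  have hpres : ∀ g : Perm α, (∀ z ∈ τ.support, g z = z) → ∀ z ∉ τ.support, g z ∉ τ.support := by
    intro g hg z hz h'
    exact hz (by rwa [g.injective (hg _ h')] at h')
  have hsw1 := hswap a b ha hb
  have hsw2 := hswap a c ha hc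
  have hu' := hinv u _ hu hsw1
  have hv' := hinv v _ hv hsw2
  rw [swap_inv] at hu' hv'
  have hwΔ : ∀ z ∉ τ.support, w z = (s * s) z := by
    intro z hz
    have h1 := hpres _ hsw2 z hz
    have h2 := hpres _ hsw1 _ h1
    have h3 := hpres _ hsw2 _ h2
    simp only [hw, s, mul_apply]
    rw [hv z hz, hu _ h1, hv' _ h2, hu' _ h3]
  have hssQ : ∀ z ∈ τ.support, (s * s) z = z := by
    intro z hz
    simp only [s, mul_apply]
    rw [hsw2 z hz, hsw1 z hz, hsw2 z hz, hsw1 z hz]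
  clear_value w s
  have hpow : ∀ k : ℕ, ∀ z ∉ τ.support, (w ^ k) z = ((s * s) ^ k) z := by
    intro k
    induction k with
    | zero => intro z _; rfl
    | succ k ih =>
      intro z hz
      rw [pow_succ, pow_succ, mul_apply, mul_apply _ (s * s), hwΔ z hz, ih _ (hpres _ hssQ z hz)]
  -- On the support, an element commuting with the cycle `τ` acts as a power of it, so the `p`-th
  -- power is trivial there. Off the support a three-cycle survives, as `p ≠ 3`.
  have hwp : w ^ p = (s * s) ^ p := by
    ext z
    by_cases hz : z ∈ τ.support
    · obtain ⟨l, hl⟩ : ∃ l : ℤ, (τ ^ l) z = w z := by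
        refine hτ.exists_zpow_eq (mem_support.1 hz) ?_
        rw [← mul_apply, ← hcomm'.eq, mul_apply]
        exact fun h => mem_support.1 hz (w.injective h)
      have h1 : ∀ k : ℕ, (w ^ k) z = (τ ^ (l * k)) z := by
        intro k
        induction k with
        | zero => simp
        | succ k ih =>
          rw [pow_succ', mul_apply, ih, ← mul_apply, (hcomm'.zpow_right _).eq, mul_apply, ← hl,
            ← mul_apply, ← zpow_add]
          congr 2
          push_cast
          ring
      rw [h1, mul_comm, zpow_mul, zpow_natCast, hpdef, ← hτ.orderOf, pow_orderOf_eq_one, one_zpow,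
        one_apply]
      exact (Perm.pow_apply_eq_self_of_apply_eq_self (hssQ z hz) _).symm
    · exact hpow p z hz
  refine alternatingGroup_le_of_isPreprimitive_of_isThreeCycle_mem hH (g := w ^ p) ?_
    (pow_mem hwH p)
  rw [hwp]
  exact isThreeCycle_pow hss3 ((Nat.coprime_primes hp Nat.prime_three).2 h3)

end

/-! ### Primitivity from cycles on the orbits -/

section

variable {α : Type*} [Fintype α] [DecidableEq α]

theorem Equiv.Perm.IsCycleOn.isCycle_and_support_eq {f : Perm α} {s : Finset α}
    (hf : f.IsCycleOn s) (hfs : f.support ⊆ s) (hs : 2 ≤ s.card) :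
    f.IsCycle ∧ f.support = s := by
  have hnt : (s : Set α).Nontrivial := Finset.one_lt_card_iff_nontrivial.1 hs
  refine ⟨isCycle_iff_exists_isCycleOn.2 ⟨s, hnt, hf, fun x hx => hfs (mem_support.2 hx)⟩,
    hfs.antisymm fun x hx => mem_support.2 (hf.apply_ne hnt hx)⟩

theorem Equiv.Perm.IsCycleOn.sign_eq {f : Perm α} {s : Finset α} (hf : f.IsCycleOn s)
    (hfs : f.support ⊆ s) (hs : s.Nonempty) : sign f = -(-1) ^ s.card := by
  rcases Nat.lt_or_ge s.card 2 with h | h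
  · have h1 : s.card = 1 := by have := hs.card_pos; omega
    obtain ⟨a, rfl⟩ := Finset.card_eq_one.1 h1
    have hf1 : f = 1 := by
      rw [← support_eq_empty_iff]
      by_contra hne
      have h2 := (two_le_card_support_of_ne_one (f := f) (by simpa using hne)).trans
        (Finset.card_le_card hfs)
      simp at h2
    simp [hf1]
  · obtain ⟨hc, hsupp⟩ := hf.isCycle_and_support_eq hfs h
    rw [hc.sign, hsupp]

/-- A permutation that is a cycle on each of two disjoint sets of coprime cardinalities, together
with the power of it that is a cycle on the first one. -/
theorem Equiv.Perm.exists_isCycleOn_isCycleOn {Q R : Finset α} (hQR : _root_.Disjoint Q R)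
    (hQ : 2 ≤ Q.card) (hR : R.Nonempty) (hcop : R.card.Coprime Q.card) :
    ∃ y : Perm α, y.IsCycleOn Q ∧ y.IsCycleOn R ∧ (∀ x ∉ Q, x ∉ R → y x = x) ∧
      (∃ τ ∈ zpowers y, τ.IsCycle ∧ τ.support = Q) ∧ sign y = (-1) ^ (Q.card + R.card) := by
  obtain ⟨f, hf, hfs⟩ := Q.exists_cycleOn
  obtain ⟨g, hg, hgs⟩ := R.exists_cycleOn
  have hfx : ∀ x ∉ Q, f x = x := fun x hx => notMem_support.1 fun h => hx (hfs h)
  have hgx : ∀ x ∉ R, g x = x := fun x hx => notMem_support.1 fun h => hx (hgs h)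
  have hd : f.Disjoint g := fun x => by
    by_cases hx : x ∈ Q
    · exact .inr (hgx x (Finset.disjoint_left.1 hQR hx))
    · exact .inl (hfx x hx)
  obtain ⟨hfc, hfsupp⟩ := hf.isCycle_and_support_eq hfs hQ
  have hgpow : g ^ R.card = 1 := by
    ext x
    by_cases hx : x ∈ R
    · exact hg.pow_card_apply hx
    · exact Perm.pow_apply_eq_self_of_apply_eq_self (hgx x hx) _
  have hcop' : R.card.Coprime (orderOf f) := by rwa [hfc.orderOf, hfsupp]
  have hcongr : ∀ (u v : Perm α) (s : Finset α), u.IsCycleOn s → (∀ x ∈ s, v x = x) →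
      u.Disjoint v → (u * v).IsCycleOn s := by
    intro u v s hu hv huv
    have hpow : ∀ x ∈ s, ∀ k : ℤ, ((u * v) ^ k) x = (u ^ k) x := by
      intro x hx k
      rw [huv.commute.mul_zpow, mul_apply, zpow_apply_eq_self_of_apply_eq_self (hv x hx)]
    refine ⟨hu.1.congr fun x hx => by rw [mul_apply, hv x hx], fun x hx z hz => ?_⟩
    obtain ⟨k, hk⟩ := hu.2 hx hz
    exact ⟨k, by rw [hpow x hx, hk]⟩
  refine ⟨f * g, hcongr f g Q hf (fun x hx => hgx x (Finset.disjoint_left.1 hQR hx)) hd, ?_, ?_,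
    ⟨f ^ R.card, ⟨R.card, ?_⟩, hfc.pow_iff.2 hcop', ?_⟩, ?_⟩
  · rw [hd.commute.eq]
    exact hcongr g f R hg (fun x hx => hfx x (Finset.disjoint_right.1 hQR hx)) hd.symm
  · intro x hxQ hxR
    rw [mul_apply, hgx x hxR, hfx x hxQ]
  · simp only [zpow_natCast]
    rw [hd.commute.mul_pow, hgpow, mul_one]
  · rw [support_pow_coprime hcop', hfsupp]
  · rw [Perm.sign_mul, hf.sign_eq hfs (Finset.card_pos.1 (by omega)), hg.sign_eq hgs hR, neg_mul_neg,
      pow_add]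

variable {H : Subgroup (Perm α)}

/-- A nontrivial block that meets the support of a cycle of prime length contains it. -/
theorem MulAction.IsBlock.support_subset_of_prime_cycle {B : Set α} (hB : IsBlock H B)
    {τ : Perm α} (hτ : τ.IsCycle) (hτH : τ ∈ H) (hp : τ.support.card.Prime) {a b : α}
    (ha : a ∈ B) (haτ : a ∈ τ.support) (hb : b ∈ B) (hab : b ≠ a) :
    (τ.support : Set α) ⊆ B := by
  have hstab : ∀ k : ℤ, ∀ u ∈ B, (τ ^ k) u ∈ B → ∀ v ∈ B, (τ ^ k) v ∈ B := by
    intro k u hu hku v hv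
    have h1 := hB.smul_eq_of_mem (g := (⟨τ ^ k, zpow_mem hτH k⟩ : H)) hu hku
    rw [← h1]
    exact Set.smul_mem_smul_set hv
  intro c hc
  -- If `b` is in the support, a power of `τ` taking `a` to `b` stabilizes `B` and generates `⟨τ⟩`,
  -- the order being prime. Otherwise `b` is fixed by `τ`, and every power stabilizes `B`.
  by_cases hbτ : b ∈ τ.support
  · obtain ⟨j, hj⟩ := hτ.exists_pow_eq (mem_support.1 haτ) (mem_support.1 hbτ)
    have hcop : j.Coprime (orderOf τ) := by
      rw [Nat.coprime_comm, hτ.orderOf, Nat.Prime.coprime_iff_not_dvd hp, ← hτ.orderOf,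
        orderOf_dvd_iff_pow_eq_one]
      intro h
      rw [h] at hj
      exact hab hj.symm
    obtain ⟨m, hm⟩ := exists_pow_eq_self_of_coprime hcop
    have hjpow : ∀ i : ℕ, ∀ v ∈ B, ((τ ^ j) ^ i) v ∈ B := by
      intro i
      induction i with
      | zero => intro v hv; exact hv
      | succ i ih =>
        intro v hv
        rw [pow_succ, mul_apply]
        have := hstab j a ha (by rw [zpow_natCast, hj]; exact hb) v hv
        rw [zpow_natCast] at this
        exact ih _ this
    have h1 : ∀ v ∈ B, τ v ∈ B := by
      intro v hv
      have := hjpow m v hv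
      rwa [hm] at this
    obtain ⟨i, rfl⟩ := hτ.exists_pow_eq (mem_support.1 haτ) (mem_support.1 hc)
    clear hc
    induction i with
    | zero => exact ha
    | succ i ih => rw [pow_succ', mul_apply]; exact h1 _ ih
  · obtain ⟨i, rfl⟩ := hτ.exists_zpow_eq (mem_support.1 haτ) (mem_support.1 hc)
    have hbi : (τ ^ i) b = b :=
      zpow_apply_eq_self_of_apply_eq_self (notMem_support.1 hbτ) i
    exact hstab i b hb (hbi.symm ▸ hb) a ha

omit [Fintype α] [DecidableEq α] in
theorem MulAction.IsBlock.mem_of_isCycleOn {B : Set α} (hB : IsBlock H B) {y : Perm α}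
    (hy : y ∈ H) {R : Set α} (hR : y.IsCycleOn R) {a : α} (ha : a ∈ B) (hya : y a ∈ B) {r : α}
    (hr : r ∈ B) (hrR : r ∈ R) : R ⊆ B := by
  have h1 := hB.smul_eq_of_mem (g := (⟨y, hy⟩ : H)) ha hya
  intro s hs
  obtain ⟨k, rfl⟩ := hR.2 hrR hs
  have h2 : (⟨y, hy⟩ : H) ^ k ∈ stabilizer H B := zpow_mem (mem_stabilizer_iff.2 h1) k
  rw [← mem_stabilizer_iff.1 h2]
  exact Set.smul_mem_smul_set hr

omit [Fintype α] [DecidableEq α] in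
theorem Subgroup.isPretransitive_of_forall_exists (a : α) (h : ∀ b, ∃ g ∈ H, g a = b) :
    IsPretransitive H α where
  exists_smul_eq b c := by
    obtain ⟨g, hg, rfl⟩ := h b
    obtain ⟨k, hk, rfl⟩ := h c
    exact ⟨⟨k * g⁻¹, mul_mem hk (inv_mem hg)⟩, by simp [Subgroup.smul_def]⟩

/-- A nontrivial block through `z` contains the support and is stabilized by `y`. It is everything
once it meets the other orbit; otherwise it equals the support, whose size does not divide the
degree. -/
theorem isPreprimitive_of_two_orbits {τ y x : Perm α} (hτ : τ.IsCycle)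
    (hp : τ.support.card.Prime) (hn : ¬ τ.support.card ∣ Fintype.card α) (hτH : τ ∈ H)
    (hyH : y ∈ H) (hxH : x ∈ H) (hy : y.IsCycleOn ((τ.support : Set α)ᶜ)) {z : α}
    (hz : z ∈ τ.support) (hxz : x z ∉ τ.support) : IsPreprimitive H α := by
  have htrans : IsPretransitive H α := by
    refine isPretransitive_of_forall_exists z fun b => ?_
    by_cases hb : b ∈ τ.support
    · obtain ⟨i, hi⟩ := hτ.exists_zpow_eq (mem_support.1 hz) (mem_support.1 hb)
      exact ⟨τ ^ i, zpow_mem hτH i, hi⟩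
    · obtain ⟨i, hi⟩ := hy.2 (show x z ∈ ((τ.support : Set α)ᶜ) from hxz)
        (show b ∈ ((τ.support : Set α)ᶜ) from hb)
      exact ⟨y ^ i * x, mul_mem (zpow_mem hyH i) hxH, hi⟩
  refine IsPreprimitive.of_isTrivialBlock_base z fun {B} hzB hB => ?_
  by_cases hsub : B.Subsingleton
  · exact .inl hsub
  right
  obtain ⟨b, hb, hbz⟩ : ∃ b ∈ B, b ≠ z := by
    by_contra! h
    exact hsub fun u hu v hv => (h u hu).trans (h v hv).symm
  have hQB := hB.support_subset_of_prime_cycle hτ hτH hp hzB hz hb hbz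
  have hyz : y z ∈ B := hQB (by
    by_contra h'
    exact (hy.apply_mem_iff.1 h') hz)
  by_cases hr : ∃ r ∈ B, r ∉ τ.support
  · obtain ⟨r, hrB, hr⟩ := hr
    have hRB := hB.mem_of_isCycleOn hyH hy hzB hyz hrB hr
    rw [Set.eq_univ_iff_forall]
    intro u
    by_cases hu : u ∈ τ.support
    · exact hQB hu
    · exact hRB hu
  · push Not at hr
    exfalso
    have hBQ : B = τ.support := Set.Subset.antisymm hr hQB
    have := hB.ncard_dvd_card ⟨z, hzB⟩
    rw [hBQ, Set.ncard_coe_finset, Nat.card_eq_fintype_card] at this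
    exact hn this

/-- A block with at least two points, one in the support `Q`, contains `Q`. Meeting the third orbit,
it misses at most `c`, and it cannot miss `c`, for lack of room for a disjoint translate. Otherwise
it is `Q ∪ {c}`, excluded by hypothesis, or `Q`; in that case the translate through the fixed point
`c` is `y`-stable and fills the complement, so the degree would be `2 * |Q|`. -/
theorem isPreprimitive_of_three_orbits [IsPretransitive H α] {τ y : Perm α} {c : α}
    (hτ : τ.IsCycle) (hp : τ.support.card.Prime) (hn : Fintype.card α ≠ 2 * τ.support.card)
    (hτH : τ ∈ H) (hyH : y ∈ H) (hyQ : y.IsCycleOn (τ.support : Set α)) (hc : c ∉ τ.support)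
    (hyc : y c = c) (hy : y.IsCycleOn ((insert c τ.support : Finset α) : Set α)ᶜ)
    (hblock : ¬ IsBlock H ((insert c τ.support : Finset α) : Set α)) : IsPreprimitive H α := by
  obtain ⟨a, ha⟩ := hτ.nonempty_support
  refine IsPreprimitive.of_isTrivialBlock_base a fun {B} haB hB => ?_
  by_cases hsub : B.Subsingleton
  · exact .inl hsub
  right
  obtain ⟨b, hb, hba⟩ : ∃ b ∈ B, b ≠ a := by
    by_contra! h
    exact hsub fun u hu v hv => (h u hu).trans (h v hv).symm
  have hQB := hB.support_subset_of_prime_cycle hτ hτH hp haB ha hb hba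
  have hya : y a ∈ B := hQB (hyQ.apply_mem_iff.2 ha)
  obtain ⟨h, hha⟩ := exists_smul_eq H a c
  have hcard : (h • B).ncard = B.ncard := Set.ncard_smul_set h B
  have hchB : c ∈ h • B := hha ▸ Set.smul_mem_smul_set haB
  have hdisj : c ∉ B → _root_.Disjoint (h • B) B := by
    intro hcB
    rcases isBlock_iff_smul_eq_or_disjoint.1 hB h with h1 | h1
    · exact absurd (h1 ▸ hchB) hcB
    · exact h1
  have hBcard : τ.support.card ≤ B.ncard := by
    rw [← Set.ncard_coe_finset]
    exact Set.ncard_le_ncard hQB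
  have h2 := hp.two_le
  by_cases hr : ∃ r ∈ B, r ∉ insert c τ.support
  · obtain ⟨r, hrB, hr⟩ := hr
    have hRB := hB.mem_of_isCycleOn hyH hy haB hya hrB (by simpa using hr)
    have hall : ∀ u, u ≠ c → u ∈ B := by
      intro u hu
      by_cases huQ : u ∈ τ.support
      · exact hQB huQ
      · exact hRB (by simp [hu, huQ])
    rw [Set.eq_univ_iff_forall]
    intro u
    by_cases hu : u = c
    · by_contra huB
      rw [hu] at huB
      have h3 : h • B ⊆ {c} := by
        intro v hv
        by_contra hvc
        exact Set.disjoint_left.1 (hdisj huB) hv (hall v hvc)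
      have h4 := Set.ncard_le_ncard h3
      rw [Set.ncard_singleton] at h4
      omega
    · exact hall u hu
  · push Not at hr
    exfalso
    by_cases hcB : c ∈ B
    · apply hblock
      have : ((insert c τ.support : Finset α) : Set α) = B := by
        refine Set.Subset.antisymm ?_ hr
        intro u hu
        rcases Finset.mem_insert.1 hu with rfl | hu
        · exact hcB
        · exact hQB hu
      rwa [this]
    · have hBQ : B = τ.support := by
        refine Set.Subset.antisymm (fun u hu => ?_) hQB
        rcases Finset.mem_insert.1 (hr u hu) with rfl | hu'
        · exact absurd hu hcB
        · exact hu'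
      have hd := hdisj hcB
      have hcardB : B.ncard = τ.support.card := by rw [hBQ, Set.ncard_coe_finset]
      obtain ⟨r, hrB, hrc⟩ : ∃ r ∈ h • B, r ≠ c := by
        by_contra! h'
        have h4 := Set.ncard_le_ncard (show h • B ⊆ {c} from h')
        rw [Set.ncard_singleton] at h4
        omega
      have hrQ : r ∉ τ.support := fun h' => Set.disjoint_left.1 hd hrB (hQB h')
      have hhB : IsBlock H (h • B) := hB.translate h
      have hRB := hhB.mem_of_isCycleOn hyH hy hchB (hyc.symm ▸ hchB) hrB (by simp [hrc, hrQ])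
      have heq : h • B = Bᶜ := by
        refine Set.Subset.antisymm (fun u hu => Set.disjoint_left.1 hd hu) fun u hu => ?_
        rw [hBQ] at hu
        by_cases huc : u = c
        · exact huc ▸ hchB
        · exact hRB (by simpa [huc] using hu)
      have := Set.ncard_add_ncard_compl B
      rw [← heq, hcard, hcardB, Nat.card_eq_fintype_card] at this
      omega

end

/-! ### Paths of mates -/

/-- Two nontrivial elements of the subgroup `A` that generate it. -/
def Subgroup.MateIn {P : Type*} [Group P] (A : Subgroup P) (x y : P) : Prop :=
  (x ∈ A ∧ x ≠ 1) ∧ (y ∈ A ∧ y ≠ 1) ∧ A ≤ closure {x, y}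

theorem Subgroup.MateIn.symm {P : Type*} [Group P] {A : Subgroup P} {x y : P}
    (h : A.MateIn x y) : A.MateIn y x :=
  ⟨h.2.1, h.1, by rw [Set.pair_comm]; exact h.2.2⟩

instance {P : Type*} [Group P] (A : Subgroup P) : Std.Symm A.MateIn := ⟨fun _ _ h => h.symm⟩

/-- The generating graph of a group that is not cyclic is connected if this holds for the
corresponding relation on its image under an embedding. -/
theorem generatingGraph_connected {G P : Type*} [Group G] [Group P] (hG : ¬ IsCyclic G)
    (φ : G →* P) (hφ : Function.Injective φ)
    (h : ∀ x y, (x ∈ φ.range ∧ x ≠ 1) → (y ∈ φ.range ∧ y ≠ 1) →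
      Relation.ReflTransGen φ.range.MateIn x y) : (generatingGraph G).Connected := by
  have hne : Nonempty {g : G // g ≠ 1} := by
    by_contra hempty
    rw [nonempty_subtype] at hempty
    push Not at hempty
    exact hG ⟨1, fun g => ⟨0, by simp [hempty g]⟩⟩
  have hadj : ∀ x y : {g : G // g ≠ 1}, φ.range.MateIn (φ x) (φ y) →
      (generatingGraph G).Adj x y := by
    intro x y hxy
    have htop : closure {(x : G), (y : G)} = ⊤ := by
      have h1 := hxy.2.2
      rw [← Set.image_pair, ← MonoidHom.map_closure, MonoidHom.range_eq_map,
        map_le_map_iff_of_injective hφ] at h1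
      exact top_le_iff.1 h1
    refine ⟨?_, htop⟩
    rintro rfl
    rw [Set.pair_eq_singleton, ← zpowers_eq_closure] at htop
    exact hG ⟨x, fun g => by
      have : g ∈ zpowers (x : G) := htop ▸ mem_top g
      exact this⟩
  refine ⟨fun x y => ?_⟩
  have hx1 : φ x ≠ 1 := fun h' => x.2 (hφ (h'.trans φ.map_one.symm))
  have key : ∀ w, Relation.ReflTransGen φ.range.MateIn (φ x) w →
      ∃ z : {g : G // g ≠ 1}, φ z = w ∧ (generatingGraph G).Reachable x z := by
    intro w hw
    induction hw with
    | refl => exact ⟨x, rfl, SimpleGraph.Reachable.refl _⟩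
    | tail _ hbc ih =>
      obtain ⟨z, rfl, hz⟩ := ih
      obtain ⟨⟨z', rfl⟩, hz'⟩ := hbc.2.1
      have hz1 : z' ≠ 1 := by
        rintro rfl
        exact hz' φ.map_one
      exact ⟨⟨z', hz1⟩, rfl, hz.trans (hadj z ⟨z', hz1⟩ hbc).reachable⟩
  have hy1 : φ y ≠ 1 := fun h' => y.2 (hφ (h'.trans φ.map_one.symm))
  obtain ⟨z, hz, hr⟩ := key _ (h (φ x) (φ y) ⟨⟨x, rfl⟩, hx1⟩ ⟨⟨y, rfl⟩, hy1⟩)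
  rwa [← Subtype.ext (hφ hz)]

theorem ne_one_of_mem_zpowers_of_isCycle {α : Type*} {y τ : Perm α} (h : τ ∈ zpowers y)
    (hτ : τ.IsCycle) : y ≠ 1 := by
  rintro rfl
  rw [zpowers_one_eq_bot, mem_bot] at h
  exact hτ.ne_one h

section

variable {α : Type*} [Fintype α] [DecidableEq α] {A : Subgroup (Perm α)} {q : ℕ}

/-- Choose `u, u'` moved by `x, x'` such that neither image is one of these two points, and let `Q`
contain `u, u'` and avoid both images. A point moved by both serves as `u = u'`; failing that, the
supports are disjoint. -/
theorem exists_finset_separating {x x' : Perm α} (hx : x ≠ 1) (hx' : x' ≠ 1) (hq : 2 ≤ q)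
    (hqn : q + 2 ≤ Fintype.card α) :
    ∃ Q : Finset α, Q.card = q ∧ (∃ u ∈ Q, x u ∉ Q) ∧ ∃ u ∈ Q, x' u ∉ Q := by
  obtain ⟨u, u', h1, h2, h3, h4⟩ :
      ∃ u u', x u ≠ u ∧ x u ≠ u' ∧ x' u' ≠ u ∧ x' u' ≠ u' := by
    by_cases h : ∃ u, x u ≠ u ∧ x' u ≠ u
    · obtain ⟨u, hu, hu'⟩ := h
      exact ⟨u, u, hu, hu, hu', hu'⟩
    · push Not at h
      obtain ⟨u, hu⟩ : ∃ u, x u ≠ u := by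
        by_contra! h'
        exact hx (Perm.ext h')
      obtain ⟨u', hu'⟩ : ∃ u, x' u ≠ u := by
        by_contra! h'
        exact hx' (Perm.ext h')
      refine ⟨u, u', hu, fun he => hu' ?_, fun he => hu' ?_, hu'⟩
      · rw [← he]
        exact h _ fun h' => hu (x.injective h')
      · have := h u hu
        exact x'.injective (by rw [he, this])
  have hsub : ({u, u'} : Finset α) ⊆ ({x u, x' u'} : Finset α)ᶜ := by
    intro v hv
    simp only [Finset.mem_insert, Finset.mem_singleton] at hv
    simp only [Finset.mem_compl, Finset.mem_insert, Finset.mem_singleton, not_or]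
    rcases hv with rfl | rfl
    · exact ⟨h1.symm, h3.symm⟩
    · exact ⟨h2.symm, h4.symm⟩
  have hc2 : ({x u, x' u'} : Finset α)ᶜ.card ≥ q := by
    have := Finset.card_le_two (a := x u) (b := x' u')
    rw [Finset.card_compl]
    omega
  obtain ⟨Q, hQ1, hQ2, hQ3⟩ := Finset.exists_subsuperset_card_eq hsub
    (Finset.card_le_two.trans hq) hc2
  refine ⟨Q, hQ3, ⟨u, hQ1 (by simp), fun h => ?_⟩, u', hQ1 (by simp), fun h => ?_⟩
  · have := hQ2 h
    simp at this
  · have := hQ2 h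
    simp at this

/-- Any two nontrivial permutations have a common mate, with a cycle of prime length. -/
theorem exists_mateIn_of_two_orbits (hq : q.Prime) (hn : ¬ q ∣ Fintype.card α)
    (hqn : q + 2 ≤ Fintype.card α)
    (hgen : ∀ H : Subgroup (Perm α), IsPreprimitive H α → ∀ τ ∈ H, τ.IsCycle →
      τ.support.card = q → A ≤ H)
    (hsign : ∀ y : Perm α, sign y = (-1) ^ Fintype.card α → y ∈ A)
    {x x' : Perm α} (hx : x ∈ A ∧ x ≠ 1) (hx' : x' ∈ A ∧ x' ≠ 1) :
    ∃ y, A.MateIn x y ∧ A.MateIn x' y := by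
  obtain ⟨Q, rfl, hu, hu'⟩ := exists_finset_separating hx.2 hx'.2 hq.two_le hqn
  have hcop : Qᶜ.card.Coprime Q.card := by
    rw [Nat.coprime_comm, Nat.Prime.coprime_iff_not_dvd hq, Finset.card_compl]
    intro h
    exact hn ((Nat.dvd_sub_iff_left (by omega) dvd_rfl).1 h)
  obtain ⟨y, -, hyR, -, ⟨τ, hτy, hτ, rfl⟩, hs⟩ := exists_isCycleOn_isCycleOn
    (disjoint_compl_right (a := Q)) hq.two_le
    (Finset.card_pos.1 (by rw [Finset.card_compl]; omega)) hcop
  have hyA : y ∈ A ∧ y ≠ 1 := by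
    refine ⟨hsign y ?_, ne_one_of_mem_zpowers_of_isCycle hτy hτ⟩
    rw [hs, Finset.card_add_card_compl]
  have key : ∀ w : Perm α, (w ∈ A ∧ w ≠ 1) → (∃ u ∈ τ.support, w u ∉ τ.support) →
      A.MateIn w y := by
    rintro w hw ⟨u, hu1, hu2⟩
    refine ⟨hw, hyA, ?_⟩
    have hyH : y ∈ closure {w, y} := subset_closure (by simp)
    have hτH : τ ∈ closure {w, y} := (zpowers_le.2 hyH) hτy
    refine hgen _ ?_ τ hτH hτ rfl
    exact isPreprimitive_of_two_orbits hτ hq hn hτH hyH (subset_closure (by simp))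
      (by rwa [← Finset.coe_compl]) hu1 hu2
  exact ⟨y, key x hx hu, key x' hx' hu'⟩

theorem Equiv.Perm.exists_of_not_isSwap {x : Perm α} (hx : x ≠ 1) (hs : ¬ x.IsSwap) :
    ∃ c z, x c ≠ c ∧ z ≠ c ∧ x z ≠ c ∧ x z ≠ z := by
  obtain ⟨c, hc⟩ : ∃ u, x u ≠ u := by
    by_contra! h'
    exact hx (Perm.ext h')
  by_contra! h
  apply hs
  have hxx : x (x c) = c := by
    by_contra h1
    exact hc (x.injective (h c (x c) hc hc h1))
  refine ⟨c, x c, hc.symm, Perm.ext fun z => ?_⟩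
  by_cases hz : z = c
  · rw [hz, swap_apply_left]
  · by_cases hz' : z = x c
    · rw [hz', swap_apply_right, hxx]
    · rw [swap_apply_of_ne_of_ne hz hz']
      exact h c z hc hz fun h' => hz' (x.injective (h'.trans hxx.symm))

/-- `y` fixes `c` and permutes transitively `Q` and the remaining points; a power of it is a cycle
on `Q`. -/
structure Equiv.Perm.IsThreeOrbit (y : Perm α) (c : α) (Q : Finset α) : Prop where
  cycleOn : y.IsCycleOn (Q : Set α)
  notMem : c ∉ Q
  apply_eq : y c = c
  cycleOn_compl : y.IsCycleOn ((insert c Q : Finset α) : Set α)ᶜ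
  exists_cycle : ∃ τ ∈ zpowers y, τ.IsCycle ∧ τ.support = Q

theorem Equiv.Perm.IsThreeOrbit.ne_one {y : Perm α} {c : α} {Q : Finset α}
    (h : y.IsThreeOrbit c Q) : y ≠ 1 := by
  obtain ⟨τ, h1, h2, -⟩ := h.exists_cycle
  exact ne_one_of_mem_zpowers_of_isCycle h1 h2

theorem Equiv.Perm.exists_isThreeOrbit {c : α} {Q : Finset α} (hq : Q.card.Prime) (hc : c ∉ Q)
    (hn : ¬ Q.card ∣ Fintype.card α - 1) (hqn : Q.card + 2 ≤ Fintype.card α) :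
    ∃ y : Perm α, y.IsThreeOrbit c Q ∧ sign y = (-1) ^ (Fintype.card α - 1) := by
  have hcard : (insert c Q)ᶜ.card = Fintype.card α - 1 - Q.card := by
    rw [Finset.card_compl, Finset.card_insert_of_notMem hc]
    omega
  have hcop : (insert c Q)ᶜ.card.Coprime Q.card := by
    rw [Nat.coprime_comm, Nat.Prime.coprime_iff_not_dvd hq, hcard]
    intro h
    exact hn ((Nat.dvd_sub_iff_left (by omega) dvd_rfl).1 h)
  have hdisj : _root_.Disjoint Q (insert c Q)ᶜ :=
    disjoint_compl_right.mono_left (Finset.subset_insert c Q)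
  obtain ⟨y, hyQ, hyR, hyc, hτ, hs⟩ := exists_isCycleOn_isCycleOn hdisj hq.two_le
    (Finset.card_pos.1 (by omega)) hcop
  refine ⟨y, ⟨hyQ, hc, hyc c hc (by simp), by rwa [← Finset.coe_compl], hτ⟩, ?_⟩
  rw [hs, hcard]
  congr 1
  omega

theorem Equiv.Perm.IsThreeOrbit.mateIn {y x : Perm α} {c : α} {Q : Finset α}
    (hy : y.IsThreeOrbit c Q) (hq : Q.card.Prime) (hn : Fintype.card α ≠ 2 * Q.card)
    (hgen : ∀ H : Subgroup (Perm α), IsPreprimitive H α → ∀ τ ∈ H, τ.IsCycle →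
      τ.support.card = Q.card → A ≤ H) (hyA : y ∈ A) (hx : x ∈ A ∧ x ≠ 1)
    (htrans : IsPretransitive (closure {x, y} : Subgroup (Perm α)) α)
    (hblock : ¬ IsBlock (closure {x, y} : Subgroup (Perm α)) ((insert c Q : Finset α) : Set α)) :
    A.MateIn x y := by
  obtain ⟨τ, hτy, hτ, rfl⟩ := hy.exists_cycle
  have hyH : y ∈ closure {x, y} := subset_closure (by simp)
  have hτH : τ ∈ closure {x, y} := (zpowers_le.2 hyH) hτy
  exact ⟨hx, ⟨hyA, hy.ne_one⟩, hgen _ (isPreprimitive_of_three_orbits hτ hq hn hτH hyH hy.cycleOn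
    hy.notMem hy.apply_eq hy.cycleOn_compl hblock) τ hτH hτ rfl⟩

/-- The image of `c` joins `c` to `Q`, and the image of `z` joins `Q` to the third orbit. The set `Q
∪ {c}` is no block: `x` keeps one of its points inside and moves another out. -/
theorem Equiv.Perm.IsThreeOrbit.mateIn_of_apply {y x : Perm α} {c z : α} {Q : Finset α}
    (hy : y.IsThreeOrbit c Q) (hq : Q.card.Prime) (hn : Fintype.card α ≠ 2 * Q.card)
    (hgen : ∀ H : Subgroup (Perm α), IsPreprimitive H α → ∀ τ ∈ H, τ.IsCycle →
      τ.support.card = Q.card → A ≤ H) (hyA : y ∈ A) (hxA : x ∈ A)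
    (hxc : x c ∈ Q) (hz : z ∈ Q) (hxz : x z ∉ insert c Q) : A.MateIn x y := by
  have hyH : y ∈ closure {x, y} := subset_closure (by simp)
  have hxH : x ∈ closure {x, y} := subset_closure (by simp)
  have hx1 : x ≠ 1 := by
    rintro rfl
    exact hxz (by simpa using .inr hz)
  refine hy.mateIn hq hn hgen hyA ⟨hxA, hx1⟩ ?_ ?_
  · refine isPretransitive_of_forall_exists c fun b => ?_
    have hQ : ∀ b ∈ Q, ∃ g ∈ closure {x, y}, g c = b := by
      intro b hb
      obtain ⟨i, hi⟩ := hy.cycleOn.2 hxc hb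
      exact ⟨y ^ i * x, mul_mem (zpow_mem hyH i) hxH, hi⟩
    by_cases hbc : b = c
    · exact ⟨1, one_mem _, hbc.symm⟩
    by_cases hb : b ∈ Q
    · exact hQ b hb
    · obtain ⟨g, hg, hgc⟩ := hQ z hz
      obtain ⟨i, hi⟩ := hy.cycleOn_compl.2
        (show x z ∈ ((insert c Q : Finset α) : Set α)ᶜ from hxz)
        (show b ∈ ((insert c Q : Finset α) : Set α)ᶜ by simp [hbc, hb])
      exact ⟨y ^ i * x * g, mul_mem (mul_mem (zpow_mem hyH i) hxH) hg, by
        rw [mul_apply, mul_apply, hgc, hi]⟩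
  · intro hB
    have h1 := hB.smul_eq_of_mem (g := (⟨x, hxH⟩ : closure {x, y})) (a := c) (by simp)
      (show x c ∈ _ by simp [hxc])
    have h2 : x z ∈ ((insert c Q : Finset α) : Set α) := by
      rw [← h1]
      exact ⟨z, by simp [hz], rfl⟩
    exact hxz h2

/-- If `Q ∪ {c}` were a block, the full cycle `x` would stabilize it, as it sends `u` back into it;
so it would contain all points, but it is too small. -/
theorem Equiv.Perm.IsThreeOrbit.mateIn_of_isCycle {y x : Perm α} {c u : α} {Q : Finset α}
    (hy : y.IsThreeOrbit c Q) (hq : Q.card.Prime) (hn : Fintype.card α ≠ 2 * Q.card)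
    (hqn : Q.card + 2 ≤ Fintype.card α)
    (hgen : ∀ H : Subgroup (Perm α), IsPreprimitive H α → ∀ τ ∈ H, τ.IsCycle →
      τ.support.card = Q.card → A ≤ H) (hyA : y ∈ A) (hxA : x ∈ A) (hx : x.IsCycle)
    (hxs : x.support = Finset.univ) (hu : u ∈ insert c Q) (hxu : x u ∈ insert c Q) :
    A.MateIn x y := by
  have hxH : x ∈ closure {x, y} := subset_closure (by simp)
  have hxon : x.IsCycleOn _root_.Set.univ := by
    have := hx.isCycleOn
    rwa [show {a | x a ≠ a} = _root_.Set.univ from Set.eq_univ_of_forall fun a =>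
      mem_support.1 (hxs ▸ Finset.mem_univ a)] at this
  refine hy.mateIn hq hn hgen hyA ⟨hxA, hx.ne_one⟩ ?_ ?_
  · refine isPretransitive_of_forall_exists c fun b => ?_
    obtain ⟨i, hi⟩ := hxon.2 (Set.mem_univ c) (Set.mem_univ b)
    exact ⟨x ^ i, zpow_mem hxH i, hi⟩
  · intro hB
    have h1 := hB.mem_of_isCycleOn hxH hxon hu hxu hu (Set.mem_univ u)
    have h2 : (insert c Q : Finset α) = Finset.univ := by
      rw [← Finset.coe_inj, Finset.coe_univ]
      exact Set.univ_subset_iff.1 h1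
    have h3 := Finset.card_insert_le c Q
    rw [h2, Finset.card_univ] at h3
    omega

end

section

variable {n : ℕ} {A : Subgroup (Perm (Fin n))} {q : ℕ}

/-- There is an `n`-cycle moving along a prescribed sequence of distinct points. -/
theorem exists_isCycle_apply_eq {m : ℕ} (hm : 2 ≤ m) (f : Fin m ↪ Fin n) :
    ∃ z : Perm (Fin n), z.IsCycle ∧ z.support = Finset.univ ∧
      ∀ (i : ℕ) (hi : i + 1 < m), z (f ⟨i, by omega⟩) = f ⟨i + 1, hi⟩ := by
  have hmn : m ≤ n := by simpa using Fintype.card_le_of_embedding f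
  have htrans : IsMultiplyPretransitive (Perm (Fin n)) (Fin n) m :=
    Equiv.Perm.isMultiplyPretransitive _ _
  obtain ⟨σ, hσ⟩ := htrans.exists_smul_eq (Fin.castLEEmb hmn) f
  have hσ' : ∀ i : Fin m, σ (Fin.castLE hmn i) = f i := fun i => DFunLike.congr_fun hσ i
  obtain ⟨k, rfl⟩ : ∃ k, n = k + 2 := ⟨n - 2, by omega⟩
  refine ⟨σ * finRotate (k + 2) * σ⁻¹, isCycle_finRotate.conj, ?_, fun i hi => ?_⟩
  · rw [support_conj, support_finRotate]
    simp
  · rw [← hσ', ← hσ', mul_apply, mul_apply, ← mul_apply σ⁻¹, inv_mul_cancel, one_apply]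
    congr 1
    ext
    rw [coe_finRotate_of_ne_last]
    · rfl
    · intro h
      have := congrArg Fin.val h
      simp at this
      omega

theorem exists_isCycle_of_two_sets {S T : Finset (Fin n)} (hS : 3 ≤ S.card) (hT : 3 ≤ T.card) :
    ∃ z : Perm (Fin n), z.IsCycle ∧ z.support = Finset.univ ∧ (∃ u ∈ S, z u ∈ S) ∧
      ∃ u ∈ T, z u ∈ T := by
  -- Two common points serve both sets. Otherwise `S \ T` still has two points, because `S` has at
  -- least three, and two disjoint pairs are placed on the cycle.
  by_cases h : 1 < (S ∩ T).card
  · obtain ⟨u, hu, v, hv, huv⟩ := Finset.one_lt_card.1 h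
    rw [Finset.mem_inter] at hu hv
    have hinj : Function.Injective ![u, v] := by
      intro i j
      fin_cases i <;> fin_cases j <;> simp [huv, huv.symm]
    obtain ⟨z, hz, hzs, hz'⟩ := exists_isCycle_apply_eq le_rfl ⟨![u, v], hinj⟩
    have h0 : z u = v := hz' 0 Nat.one_lt_two
    exact ⟨z, hz, hzs, ⟨u, hu.1, h0 ▸ hv.1⟩, u, hu.2, h0 ▸ hv.2⟩
  · have h1 : 1 < (S \ T).card := by
      have := Finset.card_sdiff_add_card_inter S T
      omega
    obtain ⟨u, hu, v, hv, huv⟩ := Finset.one_lt_card.1 h1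
    obtain ⟨u', hu', v', hv', huv'⟩ := Finset.one_lt_card.1 (show 1 < T.card by omega)
    rw [Finset.mem_sdiff] at hu hv
    have a1 : u ≠ u' := fun h => hu.2 (h ▸ hu')
    have a2 : u ≠ v' := fun h => hu.2 (h ▸ hv')
    have a3 : v ≠ u' := fun h => hv.2 (h ▸ hu')
    have a4 : v ≠ v' := fun h => hv.2 (h ▸ hv')
    have hinj : Function.Injective ![u, v, u', v'] := by
      intro i j
      fin_cases i <;> fin_cases j <;>
        simp [huv, huv.symm, huv', huv'.symm, a1, a2, a3, a4, a1.symm, a2.symm, a3.symm, a4.symm]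
    obtain ⟨z, hz, hzs, hz'⟩ := exists_isCycle_apply_eq (m := 4) (by norm_num)
      ⟨![u, v, u', v'], hinj⟩
    have l0 : 0 + 1 < 4 := by decide
    have l2 : 2 + 1 < 4 := by decide
    have h0 : z u = v := hz' 0 l0
    have h2 : z u' = v' := hz' 2 l2
    exact ⟨z, hz, hzs, ⟨u, hu.1, h0 ▸ hv.1⟩, u', hu', h2 ▸ hv'⟩

/-- Connectedness via elements with three orbits and `n`-cycles. -/
theorem reflTransGen_mateIn_of_three_orbits (hq : q.Prime) (hn : ¬ q ∣ n - 1) (hqn : q + 2 ≤ n)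
    (hn2 : n ≠ 2 * q)
    (hgen : ∀ H : Subgroup (Perm (Fin n)), IsPreprimitive H (Fin n) → ∀ τ ∈ H, τ.IsCycle →
      τ.support.card = q → A ≤ H)
    (hsign : ∀ y : Perm (Fin n), sign y = (-1) ^ (n - 1) → y ∈ A)
    (hswap : ∀ x ∈ A, x.IsSwap → ∃ w : Perm (Fin n), ¬ w.IsSwap ∧ A.MateIn x w)
    {x x' : Perm (Fin n)} (hx : x ∈ A ∧ x ≠ 1) (hx' : x' ∈ A ∧ x' ≠ 1) :
    Relation.ReflTransGen A.MateIn x x' := by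
  have h2 := hq.two_le
  have hcard : Fintype.card (Fin n) = n := Fintype.card_fin n
  have hnonswap : ∀ x : Perm (Fin n), x ∈ A ∧ x ≠ 1 → ¬ x.IsSwap →
      ∃ y c Q, y.IsThreeOrbit c Q ∧ Q.card = q ∧ y ∈ A ∧ A.MateIn x y := by
    intro x hx hs
    obtain ⟨c, z, hc, hzc, hxzc, hxz⟩ := exists_of_not_isSwap hx.2 hs
    have hsub : ({z, x c} : Finset (Fin n)) ⊆ ({c, x z} : Finset (Fin n))ᶜ := by
      intro v hv
      simp only [Finset.mem_insert, Finset.mem_singleton] at hv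
      simp only [Finset.mem_compl, Finset.mem_insert, Finset.mem_singleton, not_or]
      rcases hv with rfl | rfl
      · exact ⟨hzc, hxz.symm⟩
      · exact ⟨hc, fun h => hzc (x.injective h).symm⟩
    have hc2 : ({c, x z} : Finset (Fin n))ᶜ.card ≥ q := by
      have := Finset.card_le_two (a := c) (b := x z)
      rw [Finset.card_compl]
      omega
    obtain ⟨Q, hQ1, hQ2, rfl⟩ := Finset.exists_subsuperset_card_eq hsub
      (Finset.card_le_two.trans h2) hc2
    have hcQ : c ∉ Q := fun h => by simpa using hQ2 h
    have hxzQ : x z ∉ Q := fun h => by simpa using hQ2 h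
    obtain ⟨y, hy, hys⟩ := exists_isThreeOrbit hq hcQ (by rwa [hcard]) (by rwa [hcard])
    have hyA : y ∈ A := hsign y (by rw [hys, hcard])
    exact ⟨y, c, Q, hy, rfl, hyA, hy.mateIn_of_apply hq (by rwa [hcard]) hgen hyA hx.1
      (hQ1 (by simp)) (hQ1 (Finset.mem_insert_self z _)) (by simp [hxzc, hxzQ])⟩
  have hreach : ∀ x : Perm (Fin n), x ∈ A ∧ x ≠ 1 →
      ∃ y c Q, y.IsThreeOrbit c Q ∧ Q.card = q ∧ y ∈ A ∧ Relation.ReflTransGen A.MateIn x y := by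
    intro x hx
    by_cases hs : x.IsSwap
    · obtain ⟨w, hw, hxw⟩ := hswap x hx.1 hs
      obtain ⟨y, c, Q, h1, h2, h3, h4⟩ := hnonswap w hxw.2.1 hw
      exact ⟨y, c, Q, h1, h2, h3, (Relation.ReflTransGen.single hxw).tail h4⟩
    · obtain ⟨y, c, Q, h1, h2, h3, h4⟩ := hnonswap x hx hs
      exact ⟨y, c, Q, h1, h2, h3, Relation.ReflTransGen.single h4⟩
  obtain ⟨y, c, Q, hy, hQ, hyA, hxy⟩ := hreach x hx
  obtain ⟨y', c', Q', hy', hQ', hyA', hxy'⟩ := hreach x' hx'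
  obtain ⟨z, hz, hzs, ⟨u, hu, hzu⟩, u', hu', hzu'⟩ := exists_isCycle_of_two_sets
    (S := insert c Q) (T := insert c' Q')
    (by rw [Finset.card_insert_of_notMem hy.notMem]; omega)
    (by rw [Finset.card_insert_of_notMem hy'.notMem]; omega)
  -- An `n`-cycle has the sign `(-1) ^ (n - 1)` of the three-orbit elements, so the same hypothesis
  -- puts both in `A`.
  have hzA : z ∈ A := by
    apply hsign
    rw [hz.sign, hzs, Finset.card_univ, hcard]
    obtain ⟨m, rfl⟩ : ∃ m, n = m + 1 := ⟨n - 1, by omega⟩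
    simp [pow_succ]
  have e1 : A.MateIn z y := hy.mateIn_of_isCycle (by rwa [hQ]) (by rwa [hQ, hcard])
    (by rwa [hQ, hcard]) (by rwa [hQ]) hyA hzA hz hzs hu hzu
  have e2 : A.MateIn z y' := hy'.mateIn_of_isCycle (by rwa [hQ']) (by rwa [hQ', hcard])
    (by rwa [hQ', hcard]) (by rwa [hQ']) hyA' hzA hz hzs hu' hzu'
  exact ((hxy.tail e1.symm).tail e2).trans
    (Relation.ReflTransGen.stdSymm.symm _ _ hxy')

end

/-! ### Connectedness in each degree -/

theorem Subgroup.MateIn.conj {P : Type*} [Group P] {A : Subgroup P} [hA : A.Normal] {x y : P}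
    (h : A.MateIn x y) (g : P) : A.MateIn (g * x * g⁻¹) (g * y * g⁻¹) := by
  have hne : ∀ w : P, w ≠ 1 → g * w * g⁻¹ ≠ 1 := fun w hw h' => hw (conj_eq_one_iff.1 h')
  refine ⟨⟨hA.conj_mem _ h.1.1 g, hne x h.1.2⟩, ⟨hA.conj_mem _ h.2.1.1 g, hne y h.2.1.2⟩, ?_⟩
  intro w hw
  have h1 := h.2.2 (hA.conj_mem w hw g⁻¹)
  have h2 := mem_map_of_mem (MulAut.conj g).toMonoidHom h1
  rw [MonoidHom.map_closure, Set.image_pair] at h2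
  simpa [mul_assoc] using h2

/-- Write `m = 2 * k`. Bertrand's postulate for `k - 1` gives a prime `p` with `k ≤ p ≤ 2 * k - 2`,
odd and so at most `2 * k - 3`. It divides `m` only if `p = k`; then `m = 2 * p` with `p ≥ 5`, and 3
does the job. -/
theorem Nat.exists_prime_not_dvd_of_even {m : ℕ} (hm : Even m) (h8 : 8 ≤ m) :
    ∃ q, q.Prime ∧ q ≠ 2 ∧ q + 3 ≤ m ∧ ¬ q ∣ m := by
  obtain ⟨k, rfl⟩ := hm
  obtain ⟨p, hp, hp1, hp2⟩ := Nat.exists_prime_lt_and_le_two_mul (k - 1) (by omega)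
  have hodd : p % 2 = 1 := (hp.eq_two_or_odd).resolve_left (by omega)
  by_cases hd : p ∣ k + k
  · obtain ⟨j, hj⟩ := hd
    have hj2 : j = 2 := by
      have h1 : j < 3 := by
        by_contra! h
        have := Nat.mul_le_mul_left p h
        omega
      interval_cases j <;> omega
    subst hj2
    refine ⟨3, Nat.prime_three, by norm_num, by omega, fun h => ?_⟩
    rw [hj] at h
    rcases (Nat.Prime.dvd_mul Nat.prime_three).1 h with h | h
    · have := (Nat.prime_dvd_prime_iff_eq Nat.prime_three hp).1 h
      omega
    · omega
  · exact ⟨p, hp, by omega, by omega, hd⟩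

section

variable {n : ℕ}

/-- Here `q = 2`: a primitive group with a transposition is symmetric. Odd `n` allows two orbits;
even `n` needs three, and transpositions are linked to an `n`-cycle taking one of their points to
the other. -/
theorem reflTransGen_mateIn_top (hn : 5 ≤ n) {x x' : Perm (Fin n)} (hx : x ≠ 1) (hx' : x' ≠ 1) :
    Relation.ReflTransGen (⊤ : Subgroup (Perm (Fin n))).MateIn x x' := by
  have hgen : ∀ H : Subgroup (Perm (Fin n)), IsPreprimitive H (Fin n) → ∀ τ ∈ H, τ.IsCycle →
      τ.support.card = 2 → ⊤ ≤ H := fun H hH τ hτH _ hc =>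
    (subgroup_eq_top_of_isPreprimitive_of_isSwap_mem hH τ (card_support_eq_two.1 hc) hτH).ge
  rcases Nat.even_or_odd n with he | ho
  · refine reflTransGen_mateIn_of_three_orbits Nat.prime_two ?_ (by omega) (by omega) hgen
      (fun y _ => mem_top y) ?_ ⟨mem_top x, hx⟩ ⟨mem_top x', hx'⟩
    · obtain ⟨k, rfl⟩ := he
      omega
    · rintro x - ⟨a, b, hab, rfl⟩
      have hinj : Function.Injective ![a, b] := by
        intro i j
        fin_cases i <;> fin_cases j <;> simp [hab, hab.symm]
      obtain ⟨w, hw, hws, hw'⟩ := exists_isCycle_apply_eq le_rfl ⟨![a, b], hinj⟩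
      have hwa : w a = b := hw' 0 Nat.one_lt_two
      refine ⟨w, fun h => ?_, ⟨mem_top _, fun h => hab (swap_eq_one_iff.1 h)⟩,
        ⟨mem_top _, hw.ne_one⟩, ?_⟩
      · have := card_support_eq_two.2 h
        rw [hws, Finset.card_univ, Fintype.card_fin] at this
        omega
      · have := closure_cycle_adjacent_swap hw hws a
        rw [hwa, Set.pair_comm] at this
        rw [this]
  · obtain ⟨y, h1, h2⟩ := exists_mateIn_of_two_orbits (A := (⊤ : Subgroup (Perm (Fin n))))
      Nat.prime_two (by rw [Fintype.card_fin]; exact ho.not_two_dvd_nat)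
      (by rw [Fintype.card_fin]; omega) hgen (fun y _ => mem_top y) ⟨mem_top x, hx⟩
      ⟨mem_top x', hx'⟩
    exact (Relation.ReflTransGen.single h1).tail h2.symm

theorem IsPreprimitive.alternatingGroup_le {q : ℕ} (hq : q.Prime) (hqn : q = 3 ∨ q + 3 ≤ n)
    (H : Subgroup (Perm (Fin n))) (hH : IsPreprimitive H (Fin n)) (τ : Perm (Fin n))
    (hτH : τ ∈ H) (hτ : τ.IsCycle) (hc : τ.support.card = q) : alternatingGroup (Fin n) ≤ H :=
  alternatingGroup_le_of_isPreprimitive_of_prime_cycle_mem hH hτ hτH (by rwa [hc])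
    (by rwa [hc, Fintype.card_fin])

theorem reflTransGen_mateIn_alternatingGroup_of_even (he : Even n) (hn : 8 ≤ n)
    {x x' : Perm (Fin n)} (hx : x ∈ alternatingGroup (Fin n) ∧ x ≠ 1)
    (hx' : x' ∈ alternatingGroup (Fin n) ∧ x' ≠ 1) :
    Relation.ReflTransGen (alternatingGroup (Fin n)).MateIn x x' := by
  obtain ⟨q, hq, -, hqn, hd⟩ := Nat.exists_prime_not_dvd_of_even he hn
  obtain ⟨y, h1, h2⟩ := exists_mateIn_of_two_orbits hq (by rwa [Fintype.card_fin])
    (by rw [Fintype.card_fin]; omega) (IsPreprimitive.alternatingGroup_le hq (.inr hqn))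
    (fun y hy => by rw [mem_alternatingGroup, hy, Fintype.card_fin, he.neg_one_pow]) hx hx'
  exact (Relation.ReflTransGen.single h1).tail h2.symm

/-- For odd `n` an element with two orbits is odd, so three orbits are used. In degree 7 the method
fails: 2 and 3, the only primes at most 4, divide 6. -/
theorem reflTransGen_mateIn_alternatingGroup_of_odd (ho : Odd n) (hn : 5 ≤ n) (h7 : n ≠ 7)
    {x x' : Perm (Fin n)} (hx : x ∈ alternatingGroup (Fin n) ∧ x ≠ 1)
    (hx' : x' ∈ alternatingGroup (Fin n) ∧ x' ≠ 1) :
    Relation.ReflTransGen (alternatingGroup (Fin n)).MateIn x x' := by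
  obtain ⟨q, hq, hq3, hqn, hd⟩ : ∃ q, q.Prime ∧ (q = 3 ∨ q + 3 ≤ n) ∧ q + 2 ≤ n ∧ ¬ q ∣ n - 1 := by
    rcases hn.eq_or_lt with rfl | hn
    · exact ⟨3, Nat.prime_three, by norm_num, by norm_num, by norm_num⟩
    · have h9 : 9 ≤ n := by
        obtain ⟨k, rfl⟩ := ho
        omega
      obtain ⟨q, hq, -, hqn, hd⟩ := Nat.exists_prime_not_dvd_of_even (m := n - 1)
        (by obtain ⟨k, rfl⟩ := ho; exact ⟨k, by omega⟩) (by omega)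
      exact ⟨q, hq, .inr (by omega), by omega, hd⟩
  refine reflTransGen_mateIn_of_three_orbits hq hd hqn ?_ (IsPreprimitive.alternatingGroup_le hq hq3)
    (fun y hy => ?_) (fun x hx hs => ?_) hx hx'
  · obtain ⟨k, rfl⟩ := ho
    omega
  · obtain ⟨k, rfl⟩ := ho
    rw [mem_alternatingGroup, hy, Nat.add_sub_cancel, pow_mul]
    simp
  · rw [mem_alternatingGroup, hs.sign_eq] at hx
    exact absurd hx (by decide)

end

/-! ### The alternating group of degree six -/

/-- The lengths of the cycles of a nontrivial even permutation of six points. -/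
theorem cycleType_of_mem_alternatingGroup_six {x : Perm (Fin 6)}
    (hx : x ∈ alternatingGroup (Fin 6)) (hx1 : x ≠ 1) :
    x.cycleType = {3} ∨ x.cycleType = {5} ∨ x.cycleType = {2, 2} ∨ x.cycleType = {3, 3} ∨
      x.cycleType = {4, 2} := by
  have hsum : x.cycleType.sum ≤ 6 := by simpa using sum_cycleType_le x
  have hsign := sign_of_cycleType x
  rw [mem_alternatingGroup.1 hx] at hsign
  have heven : Even (x.cycleType.sum + Multiset.card x.cycleType) := by
    by_contra h
    rw [(Nat.not_even_iff_odd.1 h).neg_one_pow] at hsign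
    exact absurd hsign (by decide)
  have h2 : ∀ k ∈ x.cycleType, 2 ≤ k := fun k hk => two_le_of_mem_cycleType hk
  have hpos := card_cycleType_pos.2 hx1
  generalize x.cycleType = s at *
  have hcard : Multiset.card s ≤ 3 := by
    have := Multiset.card_nsmul_le_sum h2
    rw [smul_eq_mul] at this
    omega
  obtain h | h | h : Multiset.card s = 1 ∨ Multiset.card s = 2 ∨ Multiset.card s = 3 := by omega
  · obtain ⟨a, rfl⟩ := Multiset.card_eq_one.1 h
    simp only [Multiset.sum_singleton, Multiset.card_singleton] at hsum heven
    have := h2 a (by simp)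
    interval_cases a <;> first | exact absurd heven (by decide) | simp
  · obtain ⟨a, b, rfl⟩ := Multiset.card_eq_two.1 h
    simp only [Multiset.insert_eq_cons, Multiset.sum_cons, Multiset.sum_singleton,
      Multiset.card_cons, Multiset.card_singleton] at hsum heven
    have ha := h2 a (by simp)
    have hb := h2 b (by simp)
    have ha' : a ≤ 4 := by omega
    have hb' : b ≤ 4 := by omega
    interval_cases a <;> interval_cases b <;>
      first | omega | exact absurd heven (by decide) | decide
  · obtain ⟨a, b, c, rfl⟩ := Multiset.card_eq_three.1 h
    simp only [Multiset.insert_eq_cons, Multiset.sum_cons, Multiset.sum_singleton,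
      Multiset.card_cons, Multiset.card_singleton] at hsum heven
    have ha := h2 a (by simp)
    have hb := h2 b (by simp)
    have hc := h2 c (by simp)
    have : a = 2 ∧ b = 2 ∧ c = 2 := by omega
    obtain ⟨rfl, rfl, rfl⟩ := this
    exact absurd heven (by decide)

/-- A five-cycle and an element moving its fixed point generate the alternating group of degree
six if they generate a three-cycle. -/
theorem mateIn_alternatingGroup_six {x y w : Perm (Fin 6)} (hx : x ∈ alternatingGroup (Fin 6))
    (hy : y.IsCycle) (hy5 : y.support.card = 5) {a : Fin 6} (ha : y a = a) (hxa : x a ≠ a)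
    (hw : w.IsThreeCycle) (hwH : w ∈ closure {x, y}) :
    (alternatingGroup (Fin 6)).MateIn x y := by
  have hyA : y ∈ alternatingGroup (Fin 6) := by
    rw [mem_alternatingGroup, hy.sign, hy5]
    decide
  have hx1 : x ≠ 1 := by
    rintro rfl
    exact hxa rfl
  have hyH : y ∈ closure {x, y} := subset_closure (by simp)
  have hsupp : (y.support : Set (Fin 6))ᶜ = {a} := by
    have h1 : y.supportᶜ.card = 1 := by rw [Finset.card_compl, hy5]; rfl
    obtain ⟨b, hb⟩ := Finset.card_eq_one.1 h1
    have hab : a ∈ y.supportᶜ := by simpa using ha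
    rw [hb, Finset.mem_singleton] at hab
    rw [← Finset.coe_compl, hb, hab, Finset.coe_singleton]
  refine ⟨⟨hx, hx1⟩, ⟨hyA, hy.ne_one⟩, ?_⟩
  refine alternatingGroup_le_of_isPreprimitive_of_isThreeCycle_mem ?_ hw hwH
  refine isPreprimitive_of_two_orbits hy (by rw [hy5]; norm_num) (by rw [hy5]; decide) hyH hyH
    (x := x) (subset_closure (by simp)) (by rw [hsupp]; exact isCycleOn_singleton.2 ha)
    (z := x⁻¹ a) ?_ ?_
  · by_contra h
    have h2 : x⁻¹ a ∈ (y.support : Set (Fin 6))ᶜ := h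
    rw [hsupp, Set.mem_singleton_iff, inv_eq_iff_eq] at h2
    exact hxa h2.symm
  · rw [← mul_apply, mul_inv_cancel, one_apply]
    simpa using ha

set_option maxRecDepth 4000 in
/-- Every nontrivial even permutation of six points that is not a five-cycle has a mate that is a
five-cycle. -/
theorem exists_mateIn_five_cycle {x : Perm (Fin 6)} (hx : x ∈ alternatingGroup (Fin 6))
    (hx1 : x ≠ 1) (h5 : x.cycleType ≠ {5}) :
    ∃ y : Perm (Fin 6), y.cycleType = {5} ∧ (alternatingGroup (Fin 6)).MateIn x y := by
  -- Up to conjugation one representative of each cycle type is enough, as the alternating group is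
  -- normal.
  suffices ∃ u v : Perm (Fin 6), u.cycleType = x.cycleType ∧ v.cycleType = {5} ∧
      (u ∈ alternatingGroup (Fin 6) → (alternatingGroup (Fin 6)).MateIn u v) by
    obtain ⟨u, v, hu, hv, huv⟩ := this
    obtain ⟨g, rfl⟩ := isConj_iff.1 (isConj_iff_cycleType_eq.2 hu)
    refine ⟨g * v * g⁻¹, by rw [cycleType_conj, hv], (huv ?_).conj g⟩
    rw [mem_alternatingGroup] at hx ⊢
    rwa [Perm.sign_mul, Perm.sign_mul, Perm.sign_inv, mul_comm, ← mul_assoc, Int.units_mul_self,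
      one_mul] at hx
  have hform : ∀ l : List (Fin 6), l.Nodup → 2 ≤ l.length → l.formPerm.IsCycle ∧
      l.formPerm.support.card = l.length ∧ l.formPerm.cycleType = {l.length} := by
    intro l hl hl2
    have h1 := List.isCycle_formPerm hl hl2
    have h2 : l.formPerm.support.card = l.length := by
      rw [List.support_formPerm_of_nodup l hl (by rintro b rfl; simp at hl2),
        List.toFinset_card_of_nodup hl]
    exact ⟨h1, h2, by rw [h1.cycleType, h2]⟩
  have hthree : ∀ (w : Perm (Fin 6)) (a b c : Fin 6), a ≠ b → a ≠ c → b ≠ c →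
      swap a b * swap a c = w → w.IsThreeCycle := by
    rintro w a b c hab hac hbc rfl
    exact isThreeCycle_swap_mul_swap_same hab hac hbc
  have hdisj : ∀ f g : Perm (Fin 6), (∀ i, f i = i ∨ g i = i) →
      (f * g).cycleType = f.cycleType + g.cycleType := fun f g h => Disjoint.cycleType_mul h
  rcases cycleType_of_mem_alternatingGroup_six hx hx1 with h | h | h | h | h
  · obtain ⟨h1, h2, h3⟩ := hform [1, 2, 3, 4, 5] (by decide) (by decide)
    refine ⟨[0, 1, 2].formPerm, _, ?_, h3, fun hu => ?_⟩
    · rw [(hform _ (by decide) (by decide)).2.2, h]; rfl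
    · exact mateIn_alternatingGroup_six hu h1 h2 (a := 0) (by decide) (by decide)
        (hthree _ 0 2 1 (by decide) (by decide) (by decide) (by decide))
        (subset_closure (Set.mem_insert _ _))
  · exact absurd h h5
  · obtain ⟨h1, h2, h3⟩ := hform [1, 2, 3, 4, 5] (by decide) (by decide)
    set y : Perm (Fin 6) := List.formPerm [1, 2, 3, 4, 5] with hy
    refine ⟨[0, 1].formPerm * [2, 3].formPerm, y, ?_, h3, fun hu => ?_⟩
    · rw [hdisj _ _ (by decide), (hform _ (by decide) (by decide)).2.2, (hform _ (by decide) (by decide)).2.2, h]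
      rfl
    · set u : Perm (Fin 6) := [0, 1].formPerm * [2, 3].formPerm with hu'
      have hyH : y ∈ closure {u, y} := subset_closure (by simp)
      have huH : u ∈ closure {u, y} := subset_closure (by simp)
      -- An explicit word in the two generators is a three-cycle, which is checked by evaluation; in
      -- the next two cases the product `u * y` already is one.
      exact mateIn_alternatingGroup_six hu h1 h2 (a := 0) (by decide) (by decide)
        (hthree (u * y * u * y ^ 2 * u * y ^ 3) 0 4 2 (by decide) (by decide) (by decide)
          (by decide))
        (mul_mem (mul_mem (mul_mem (mul_mem (mul_mem huH hyH) huH) (pow_mem hyH 2)) huH)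
          (pow_mem hyH 3))
  · obtain ⟨h1, h2, h3⟩ := hform [1, 3, 5, 4, 2] (by decide) (by decide)
    set y : Perm (Fin 6) := List.formPerm [1, 3, 5, 4, 2] with hy
    refine ⟨[0, 1, 2].formPerm * [3, 4, 5].formPerm, y, ?_, h3, fun hu => ?_⟩
    · rw [hdisj _ _ (by decide), (hform _ (by decide) (by decide)).2.2, (hform _ (by decide) (by decide)).2.2, h]
      rfl
    · set u : Perm (Fin 6) := [0, 1, 2].formPerm * [3, 4, 5].formPerm with hu'
      exact mateIn_alternatingGroup_six hu h1 h2 (a := 0) (by decide) (by decide)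
        (hthree (u * y) 0 4 1 (by decide) (by decide) (by decide) (by decide))
        (mul_mem (subset_closure (by simp)) (subset_closure (by simp)))
  · obtain ⟨h1, h2, h3⟩ := hform [1, 4, 5, 3, 2] (by decide) (by decide)
    set y : Perm (Fin 6) := List.formPerm [1, 4, 5, 3, 2] with hy
    refine ⟨[0, 1, 2, 3].formPerm * [4, 5].formPerm, y, ?_, h3, fun hu => ?_⟩
    · rw [hdisj _ _ (by decide), (hform _ (by decide) (by decide)).2.2, (hform _ (by decide) (by decide)).2.2, h]
      rfl
    · set u : Perm (Fin 6) := [0, 1, 2, 3].formPerm * [4, 5].formPerm with hu'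
      exact mateIn_alternatingGroup_six hu h1 h2 (a := 0) (by decide) (by decide)
        (hthree (u * y) 0 5 1 (by decide) (by decide) (by decide) (by decide))
        (mul_mem (subset_closure (by simp)) (subset_closure (by simp)))

theorem reflTransGen_mateIn_alternatingGroup_six {x x' : Perm (Fin 6)}
    (hx : x ∈ alternatingGroup (Fin 6) ∧ x ≠ 1) (hx' : x' ∈ alternatingGroup (Fin 6) ∧ x' ≠ 1) :
    Relation.ReflTransGen (alternatingGroup (Fin 6)).MateIn x x' := by
  have hreach : ∀ x : Perm (Fin 6), x ∈ alternatingGroup (Fin 6) ∧ x ≠ 1 →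
      ∃ y : Perm (Fin 6), y.cycleType = {5} ∧
        Relation.ReflTransGen (alternatingGroup (Fin 6)).MateIn x y := by
    intro x hx
    by_cases h5 : x.cycleType = {5}
    · exact ⟨x, h5, .refl⟩
    · obtain ⟨y, hy, hxy⟩ := exists_mateIn_five_cycle hx.1 hx.2 h5
      exact ⟨y, hy, .single hxy⟩
  have hfive : ∀ y : Perm (Fin 6), y.cycleType = {5} →
      y.IsCycle ∧ y.support.card = 5 ∧ ∃ a, y a = a := by
    intro y hy
    have h1 : y.support.card = 5 := by rw [← sum_cycleType, hy]; rfl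
    refine ⟨card_cycleType_eq_one.1 (by rw [hy]; rfl), h1, ?_⟩
    by_contra! h
    have : y.support = Finset.univ := Finset.eq_univ_iff_forall.2 fun a => mem_support.2 (h a)
    rw [this] at h1
    simp at h1
  obtain ⟨y, hy, hxy⟩ := hreach x hx
  obtain ⟨y', hy', hxy'⟩ := hreach x' hx'
  obtain ⟨h1, h2, a, ha⟩ := hfive y hy
  obtain ⟨h1', h2', a', ha'⟩ := hfive y' hy'
  -- Two five-cycles have a common mate: a three-cycle moving the fixed point of each.
  obtain ⟨b, c, hab, hac, hbc, hmem⟩ : ∃ b c : Fin 6, a ≠ b ∧ a ≠ c ∧ b ≠ c ∧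
      (a' = a ∨ a' = b) := by
    have : ∀ a a' : Fin 6, ∃ b c : Fin 6, a ≠ b ∧ a ≠ c ∧ b ≠ c ∧ (a' = a ∨ a' = b) := by decide
    exact this a a'
  have hw : (swap a b * swap a c).IsThreeCycle := isThreeCycle_swap_mul_swap_same hab hac hbc
  have hwA := hw.mem_alternatingGroup
  have hwa : (swap a b * swap a c) a ≠ a := by
    rw [mul_apply, swap_apply_left, swap_apply_of_ne_of_ne hac.symm hbc.symm]
    exact hac.symm
  have hwa' : (swap a b * swap a c) a' ≠ a' := by
    rcases hmem with rfl | rfl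
    · exact hwa
    · rw [mul_apply, swap_apply_of_ne_of_ne hab.symm hbc, swap_apply_right]
      exact hab
  have e1 := mateIn_alternatingGroup_six hwA h1 h2 ha hwa hw (subset_closure (by simp))
  have e2 := mateIn_alternatingGroup_six hwA h1' h2' ha' hwa' hw (subset_closure (by simp))
  exact ((hxy.tail e1.symm).tail e2).trans (Relation.ReflTransGen.stdSymm.symm _ _ hxy')

theorem reflTransGen_mateIn_alternatingGroup {n : ℕ} (hn : 5 ≤ n) (h7 : n ≠ 7)
    {x x' : Perm (Fin n)} (hx : x ∈ alternatingGroup (Fin n) ∧ x ≠ 1)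
    (hx' : x' ∈ alternatingGroup (Fin n) ∧ x' ≠ 1) :
    Relation.ReflTransGen (alternatingGroup (Fin n)).MateIn x x' := by
  rcases Nat.even_or_odd n with he | ho
  · rcases Nat.lt_or_ge n 8 with h8 | h8
    · have h6 : n = 6 := by
        obtain ⟨k, rfl⟩ := he
        omega
      subst h6
      exact reflTransGen_mateIn_alternatingGroup_six hx hx'
    · exact reflTransGen_mateIn_alternatingGroup_of_even he h8 hx hx'
  · exact reflTransGen_mateIn_alternatingGroup_of_odd ho hn h7 hx hx'

/-! ### Conclusion -/

theorem generatingGraph_perm_connected {n : ℕ} (hn : 5 ≤ n) :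
    (generatingGraph (Perm (Fin n))).Connected := by
  refine generatingGraph_connected (not_isCyclic_perm (by omega)) (MonoidHom.id _)
    Function.injective_id fun x y hx hy => ?_
  rw [MonoidHom.range_eq_top.2 Function.surjective_id]
  exact reflTransGen_mateIn_top hn hx.2 hy.2

theorem generatingGraph_alternatingGroup_connected {n : ℕ} (hn : 5 ≤ n) (h7 : n ≠ 7) :
    (generatingGraph (alternatingGroup (Fin n))).Connected := by
  refine generatingGraph_connected (not_isCyclic_alternatingGroup (by omega))
    (alternatingGroup (Fin n)).subtype (Subgroup.subtype_injective _) fun x y hx hy => ?_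
  rw [Subgroup.range_subtype] at hx hy ⊢
  exact reflTransGen_mateIn_alternatingGroup hn h7 hx hy

/-- The degrees not covered by the connectedness results decompose as `3 = 3`, `4 = 3 + 1` and `7 =
7`, each with the single odd exponent 1, so they are excluded by hypothesis. -/
theorem exists_isDecomposition_of_lt_five {n : ℕ} (hn : 3 ≤ n) (h : n < 5 ∨ n = 7) :
    ∃ (p k : ℕ) (a : ℕ → ℕ), IsDecomposition n p k a ∧ Odd (oddDigitCount k a) := by
  obtain rfl | rfl | rfl : n = 3 ∨ n = 4 ∨ n = 7 := by omega
  · exact ⟨3, 1, fun i => i, ⟨Nat.prime_three, rfl, one_pos, fun i hi => by omega, rfl,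
      by decide⟩, by decide⟩
  · exact ⟨3, 1, fun _ => 1, ⟨Nat.prime_three, rfl, one_pos, fun i hi => by omega, rfl,
      by decide⟩, by decide⟩
  · exact ⟨7, 1, fun i => i, ⟨by norm_num, rfl, one_pos, fun i hi => by omega, rfl,
      by decide⟩, by decide⟩
theorem propositionp (n : ℕ) (hn : 3 ≤ n) :
    -- the symmetric group
    ((∀ g : Equiv.Perm (Fin n), g ≠ 1 → n = 3 → cyclicNormalizerCard g % 4 = 2) ∧
     (∀ g : Equiv.Perm (Fin n), g ≠ 1 → n ≠ 3 →
        (¬ 4 ∣ cyclicNormalizerCard g ↔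
          ∃ (p k : ℕ) (a : ℕ → ℕ), orderOf g = p ^ k ∧ IsDecomposition n p k a ∧
            HasCycleShape g p k a)) ∧
     (∀ (g : Equiv.Perm (Fin n)) (hg : g ≠ 1),
        (¬ ∃ (p k : ℕ) (a : ℕ → ℕ), orderOf g = p ^ k ∧ IsDecomposition n p k a ∧
            HasCycleShape g p k a) →
        Even (genDegree g hg)) ∧
     ((¬ ∃ (p k : ℕ) (a : ℕ → ℕ), IsDecomposition n p k a) →
        IsEulerianGraph (generatingGraph (Equiv.Perm (Fin n))))) ∧
    -- the alternating group
    ((∀ g : alternatingGroup (Fin n), g ≠ 1 →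
        (¬ 2 ∣ cyclicNormalizerCard g ↔
          ∃ (p k : ℕ) (a : ℕ → ℕ), orderOf g = p ^ k ∧ IsDecomposition n p k a ∧
            Odd (oddDigitCount k a) ∧ HasCycleShape (g : Equiv.Perm (Fin n)) p k a)) ∧
     (∀ (g : alternatingGroup (Fin n)) (hg : g ≠ 1),
        (¬ ∃ (p k : ℕ) (a : ℕ → ℕ), orderOf g = p ^ k ∧ IsDecomposition n p k a ∧
            Odd (oddDigitCount k a) ∧ HasCycleShape (g : Equiv.Perm (Fin n)) p k a) →
        Even (genDegree g hg)) ∧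
     ((¬ ∃ (p k : ℕ) (a : ℕ → ℕ), IsDecomposition n p k a ∧ Odd (oddDigitCount k a)) →
        IsEulerianGraph (generatingGraph (alternatingGroup (Fin n))))) := 
by
  refine ⟨⟨?_, ?_, ?_, ?_⟩, ?_, ?_, ?_⟩
  · rintro g hg rfl
    exact cyclicNormalizerCard_three g hg
  · intro g hg h3
    exact not_four_dvd_cyclicNormalizerCard_iff_of_ne_three (by omega) hg
  · intro g hg h
    exact even_genDegree_perm hn hg h
  · intro h
    have hn5 : 5 ≤ n := by
      by_contra! h5
      obtain ⟨p, k, a, hd, -⟩ := exists_isDecomposition_of_lt_five hn (.inl h5)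
      exact h ⟨p, k, a, hd⟩
    refine isEulerianGraph_of_connected (generatingGraph_perm_connected hn5) fun g hg =>
      even_genDegree_perm hn hg ?_
    rintro ⟨p, k, a, -, hd, -⟩
    exact h ⟨p, k, a, hd⟩
  · intro g hg
    exact not_two_dvd_cyclicNormalizerCard_iff hg
  · intro g hg h
    exact even_genDegree_alternatingGroup hn hg h
  · intro h
    have hn5 : ¬ (n < 5 ∨ n = 7) := fun h5 => h (exists_isDecomposition_of_lt_five hn h5)
    refine isEulerianGraph_of_connected
      (generatingGraph_alternatingGroup_connected (by omega) (by omega)) fun g hg =>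
      even_genDegree_alternatingGroup hn hg ?_
    rintro ⟨p, k, a, -, hd, hodd, -⟩
    exact h ⟨p, k, a, hd, hodd⟩
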